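/- Let $(X,d)$ be a locally compact, second countable metric space with a finite Borel measure $\mu$, let $\delta>0$, and suppose that $(X,d,\mu)$ is Ahlfors $\delta$-regular: there is $C\ge 1$ with $C^{-1}r^\delta\le\mu(\overline B(x,r))\le Cr^\delta$ for all $x\in X$ and $0\le r<\operatorname{diam}X$. On the real Hilbert space $L^2(X,\mu)$ consider the form $$\mathcal E(f,g)=\frac12\int_X\int_X\frac{(f(x)-f(y))(g(x)-g(y))}{d(x,y)^{\delta}}\,d\mu(y)\,d\mu(x)$$ (the diagonal being omitted from the integral), with domain $\operatorname{Dom}\mathcal E=\{f\in L^2(X,\mu):\mathcal E(f,f)<\infty\}$, which is a Hilbert space for the inner product $\langle f,g\rangle_{L^2}+\mathcal E(f,g)$. Let $J:\operatorname{Dom}\mathcal E\hookrightarrow L^2(X,\mu)$ be the embedding. Let $R:L^2(X,\mu)\to L^2(X,\mu)$ be the bounded operator with values in $\operatorname{Dom}\mathcal E$ determined by $\langle Rf,g\rangle_{L^2}+\mathcal E(Rf,g)=\langle f,g\rangle_{L^2}$ for all $g\in\operatorname{Dom}\mathcal E$. The logarithmic Dirichlet Laplacian $\Delta$ is the operator with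 domain $R\,L^2(X,\mu)$ and $\Delta Rf=f-Rf$. For a compact operator $T$ let $s_1(T)\ge s_2(T)\ge\cdots$ be its singular values, that is, the eigenvalues of $(T^*T)^{1/2}$ counted with multiplicity and followed by zeros if there are only finitely many positive ones. Then: 1. $1+\Delta$ has a bounded inverse $(1+\Delta)^{-1}$ on $L^2(X,\mu)$, and $(1+\Delta)^{-1}$ lies in the logarithmic integral ideal $\operatorname{Li}(L^2(X,\mu))$: it is compact and $s_n((1+\Delta)^{-1})=O(1/\log n)$. 2. The eigenvectors of $\Delta$ span a dense subspace of $L^2(X,\mu)$, and the eigenvalues $\lambda_1\le\lambda_2\le\cdots$ of $\Delta$, counted with multiplicity, grow at least logarithmically: there is $c>0$ with $\lambda_n\ge c\log n$ for all large $n$ (where $\lambda_n=\infty$ if there are fewer than $n$ eigenvalues, as on a one-point space). 3. $J$ is compact, and $s_n(J)=O((\log n)^{-1/2})$. -/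

import Mathlib

set_option linter.unusedSectionVars false

open MeasureTheory Filter Asymptotics
open scoped ENNReal

noncomputable section

namespace LogLaplacian

/-! ### Ahlfors regularity -/

section Ahlfors

variable {X : Type*} [MetricSpace X] [MeasurableSpace X]

/-- `(X, d, μ)` is Ahlfors `δ`-regular: there is `C ≥ 1` such that
`C⁻¹ r ^ δ ≤ μ (closedBall x r) ≤ C r ^ δ` for all `x` and all `0 ≤ r < diam X`.
The diameter is the extended one, so that it is `∞` for an unbounded space. -/
def IsAhlforsRegular (δ : ℝ) (μ : Measure X) : Prop :=
  ∃ C : ℝ, 1 ≤ C ∧ ∀ (x : X) (r : ℝ), 0 ≤ r →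
    ENNReal.ofReal r < Metric.ediam (Set.univ : Set X) →
      ENNReal.ofReal (C⁻¹ * r ^ δ) ≤ μ (Metric.closedBall x r) ∧
        μ (Metric.closedBall x r) ≤ ENNReal.ofReal (C * r ^ δ)

end Ahlfors

/-! ### The logarithmic Dirichlet form -/

section Form

variable {X : Type*} [MetricSpace X] [MeasurableSpace X]

/-- The double integral `∫∫ |f x - f y|² / d(x, y) ^ δ dμ(y) dμ(x) ∈ [0, ∞]`.
The integrand vanishes on the diagonal. -/
def energy (δ : ℝ) (μ : Measure X) (f : X → ℝ) : ℝ≥0∞ :=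
  ∫⁻ x, ∫⁻ y, ENNReal.ofReal (|f x - f y| ^ 2 / dist x y ^ δ) ∂μ ∂μ

/-- The form `½ ∫∫ (f x - f y) (g x - g y) / d(x, y) ^ δ dμ(y) dμ(x)`. -/
def form (δ : ℝ) (μ : Measure X) (f g : X → ℝ) : ℝ :=
  1 / 2 * ∫ x, ∫ y, (f x - f y) * (g x - g y) / dist x y ^ δ ∂μ ∂μ

variable [SecondCountableTopology X] [BorelSpace X] {δ : ℝ} {μ : Measure X} [IsFiniteMeasure μ]

theorem measurable_density {f g : X → ℝ} (hf : Measurable f) (hg : Measurable g) :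
    Measurable fun p : X × X => (f p.1 - f p.2) * (g p.1 - g p.2) / dist p.1 p.2 ^ δ := by
  have hd : Measurable fun p : X × X => dist p.1 p.2 := measurable_dist
  exact (((hf.comp measurable_fst).sub (hf.comp measurable_snd)).mul
    ((hg.comp measurable_fst).sub (hg.comp measurable_snd))).div (hd.pow_const δ)

theorem energy_eq_prod {f : X → ℝ} (hf : Measurable f) :
    energy δ μ f =
      ∫⁻ p : X × X, ENNReal.ofReal ((f p.1 - f p.2) * (f p.1 - f p.2) / dist p.1 p.2 ^ δ)
        ∂(μ.prod μ) := by
  rw [lintegral_prod _ (measurable_density hf hf).ennreal_ofReal.aemeasurable]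
  simp [energy, sq]

theorem ae_prod_fst {P : X → Prop} (h : ∀ᵐ x ∂μ, P x) : ∀ᵐ p ∂(μ.prod μ), P p.1 :=
  Measure.quasiMeasurePreserving_fst.ae h

theorem ae_prod_snd {P : X → Prop} (h : ∀ᵐ x ∂μ, P x) : ∀ᵐ p ∂(μ.prod μ), P p.2 :=
  Measure.quasiMeasurePreserving_snd.ae h

theorem energy_congr {f g : X → ℝ} (h : f =ᵐ[μ] g) : energy δ μ f = energy δ μ g := by
  unfold energy
  refine lintegral_congr_ae ?_
  filter_upwards [h] with x hx
  refine lintegral_congr_ae ?_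
  filter_upwards [h] with y hy
  rw [hx, hy]

theorem form_congr {f f' g g' : X → ℝ} (hf : f =ᵐ[μ] f') (hg : g =ᵐ[μ] g') :
    form δ μ f g = form δ μ f' g' := by
  unfold form
  congr 1
  refine integral_congr_ae ?_
  filter_upwards [hf, hg] with x hx hx'
  refine integral_congr_ae ?_
  filter_upwards [hf, hg] with y hy hy'
  rw [hx, hx', hy, hy']

theorem energy_add_lt_top {f g : X → ℝ} (hf : Measurable f) (hg : Measurable g)
    (hf' : energy δ μ f < ∞) (hg' : energy δ μ g < ∞) : energy δ μ (f + g) < ∞ := by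
  rw [energy_eq_prod (hf.add hg)]
  rw [energy_eq_prod hf] at hf'
  rw [energy_eq_prod hg] at hg'
  refine lt_of_le_of_lt (lintegral_mono (g := fun p : X × X =>
    2 * ENNReal.ofReal ((f p.1 - f p.2) * (f p.1 - f p.2) / dist p.1 p.2 ^ δ) +
    2 * ENNReal.ofReal ((g p.1 - g p.2) * (g p.1 - g p.2) / dist p.1 p.2 ^ δ)) ?_) ?_
  · intro p
    have hd : 0 ≤ dist p.1 p.2 ^ δ := Real.rpow_nonneg dist_nonneg _
    have h2 : (2 : ℝ≥0∞) = ENNReal.ofReal 2 := by simp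
    dsimp only
    rw [h2, ← ENNReal.ofReal_mul (by norm_num), ← ENNReal.ofReal_mul (by norm_num),
      ← ENNReal.ofReal_add (mul_nonneg (by norm_num) (div_nonneg (mul_self_nonneg _) hd))
        (mul_nonneg (by norm_num) (div_nonneg (mul_self_nonneg _) hd))]
    refine ENNReal.ofReal_le_ofReal ?_
    rw [← mul_div_assoc, ← mul_div_assoc, ← add_div]
    refine div_le_div_of_nonneg_right ?_ hd
    simp only [Pi.add_apply]
    nlinarith [sq_nonneg ((f p.1 - f p.2) - (g p.1 - g p.2))]
  · rw [lintegral_add_left (by exact ((measurable_density hf hf).ennreal_ofReal.const_mul 2)),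
      lintegral_const_mul _ (by exact (measurable_density hf hf).ennreal_ofReal),
      lintegral_const_mul _ (by exact (measurable_density hg hg).ennreal_ofReal)]
    exact ENNReal.add_lt_top.2 ⟨ENNReal.mul_lt_top (by simp) hf', ENNReal.mul_lt_top (by simp) hg'⟩

theorem energy_smul_lt_top (c : ℝ) {f : X → ℝ} (hf : Measurable f)
    (hf' : energy δ μ f < ∞) : energy δ μ (c • f) < ∞ := by
  rw [energy_eq_prod (hf.const_smul c)]
  rw [energy_eq_prod hf] at hf'
  have : ∀ p : X × X, ENNReal.ofReal (((c • f) p.1 - (c • f) p.2) * ((c • f) p.1 - (c • f) p.2) /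
      dist p.1 p.2 ^ δ) = ENNReal.ofReal (c ^ 2) *
      ENNReal.ofReal ((f p.1 - f p.2) * (f p.1 - f p.2) / dist p.1 p.2 ^ δ) := by
    intro p
    rw [← ENNReal.ofReal_mul (sq_nonneg c)]
    congr 1
    simp only [Pi.smul_apply, smul_eq_mul]
    ring
  simp_rw [this]
  rw [lintegral_const_mul _ (by exact (measurable_density hf hf).ennreal_ofReal)]
  exact ENNReal.mul_lt_top (by simp) hf'

theorem integrable_density {f g : X → ℝ} (hf : Measurable f) (hg : Measurable g)
    (hf' : energy δ μ f < ∞) (hg' : energy δ μ g < ∞) :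
    Integrable (fun p : X × X => (f p.1 - f p.2) * (g p.1 - g p.2) / dist p.1 p.2 ^ δ)
      (μ.prod μ) := by
  have key : ∀ {h : X → ℝ}, Measurable h → energy δ μ h < ∞ →
      Integrable (fun p : X × X => (h p.1 - h p.2) * (h p.1 - h p.2) / dist p.1 p.2 ^ δ)
        (μ.prod μ) := by
    intro h hm hE
    refine ⟨(measurable_density hm hm).aestronglyMeasurable, ?_⟩
    rw [hasFiniteIntegral_iff_ofReal (Eventually.of_forall fun p =>
      div_nonneg (mul_self_nonneg _) (Real.rpow_nonneg dist_nonneg _)), ← energy_eq_prod hm]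
    exact hE
  refine Integrable.mono' ((key hf hf').add (key hg hg'))
    (measurable_density hf hg).aestronglyMeasurable (Eventually.of_forall fun p => ?_)
  have hd : 0 ≤ dist p.1 p.2 ^ δ := Real.rpow_nonneg dist_nonneg _
  simp only [Pi.add_apply]
  rw [Real.norm_eq_abs, abs_div, abs_of_nonneg hd, ← add_div]
  refine div_le_div_of_nonneg_right ?_ hd
  rw [abs_le]
  constructor <;> nlinarith [sq_nonneg ((f p.1 - f p.2) - (g p.1 - g p.2)),
    sq_nonneg ((f p.1 - f p.2) + (g p.1 - g p.2))]

theorem form_eq_prod {f g : X → ℝ} (hf : Measurable f) (hg : Measurable g)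
    (hf' : energy δ μ f < ∞) (hg' : energy δ μ g < ∞) :
    form δ μ f g = 1 / 2 * ∫ p : X × X,
      (f p.1 - f p.2) * (g p.1 - g p.2) / dist p.1 p.2 ^ δ ∂(μ.prod μ) := by
  rw [form, integral_prod _ (integrable_density hf hg hf' hg')]

theorem form_comm (f g : X → ℝ) : form δ μ f g = form δ μ g f := by
  simp only [form, mul_comm]

theorem form_self_eq {f : X → ℝ} (hf : Measurable f) (hf' : energy δ μ f < ∞) :
    form δ μ f f = 1 / 2 * (energy δ μ f).toReal := by
  rw [form_eq_prod hf hf hf' hf', energy_eq_prod hf,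
    integral_eq_lintegral_of_nonneg_ae (Eventually.of_forall fun p =>
      div_nonneg (mul_self_nonneg _) (Real.rpow_nonneg dist_nonneg _))
      (measurable_density hf hf).aestronglyMeasurable]

theorem form_add_left {f g h : X → ℝ} (hf : Measurable f) (hg : Measurable g) (hh : Measurable h)
    (hf' : energy δ μ f < ∞) (hg' : energy δ μ g < ∞) (hh' : energy δ μ h < ∞) :
    form δ μ (f + g) h = form δ μ f h + form δ μ g h := by
  rw [form_eq_prod (hf.add hg) hh (energy_add_lt_top hf hg hf' hg') hh',
    form_eq_prod hf hh hf' hh', form_eq_prod hg hh hg' hh', ← mul_add,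
    ← integral_add (integrable_density hf hh hf' hh') (integrable_density hg hh hg' hh')]
  congr 1
  refine integral_congr_ae (Eventually.of_forall fun p => ?_)
  simp only [Pi.add_apply]
  ring

theorem form_smul_left (c : ℝ) (f g : X → ℝ) : form δ μ (c • f) g = c * form δ μ f g := by
  have : ∀ x y : X, ((c • f) x - (c • f) y) * (g x - g y) / dist x y ^ δ =
      c * ((f x - f y) * (g x - g y) / dist x y ^ δ) := by
    intro x y
    simp only [Pi.smul_apply, smul_eq_mul]
    ring
  simp only [form, this, integral_const_mul]
  ring

variable (δ μ)

/-- The domain of the form, `{f ∈ L²(X, μ) : ∫∫ |f x - f y|² / d(x, y) ^ δ dμ dμ < ∞}`. -/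
def formDomain : Submodule ℝ (Lp ℝ 2 μ) where
  carrier := {f | energy δ μ f < ∞}
  zero_mem' := by
    change energy δ μ _ < ∞
    rw [energy_congr (Lp.coeFn_zero ℝ 2 μ)]
    simp [energy]
  add_mem' {f g} hf hg := by
    change energy δ μ _ < ∞
    rw [energy_congr (Lp.coeFn_add f g)]
    exact energy_add_lt_top (Lp.stronglyMeasurable f).measurable
      (Lp.stronglyMeasurable g).measurable hf hg
  smul_mem' c f hf := by
    change energy δ μ _ < ∞
    rw [energy_congr (Lp.coeFn_smul c f)]
    exact energy_smul_lt_top c (Lp.stronglyMeasurable f).measurable hf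

/-- A copy of `formDomain`, to carry the form inner product `⟪f, g⟫ + form f g` instead of the
inner product of `L²(X, μ)`. -/
def FormDomain : Type _ := ↥(formDomain δ μ)

instance : AddCommGroup (FormDomain δ μ) := inferInstanceAs (AddCommGroup ↥(formDomain δ μ))

instance : Module ℝ (FormDomain δ μ) := inferInstanceAs (Module ℝ ↥(formDomain δ μ))

/-- The embedding of the form domain into `L²(X, μ)`, as a linear map. -/
def embeddingₗ : FormDomain δ μ →ₗ[ℝ] Lp ℝ 2 μ := (formDomain δ μ).subtype

variable {δ μ}

theorem embeddingₗ_injective : Function.Injective (embeddingₗ δ μ) :=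
  (formDomain δ μ).injective_subtype

theorem energy_lt_top (f : FormDomain δ μ) : energy δ μ (embeddingₗ δ μ f) < ∞ := f.2

theorem measurable_coe (f : FormDomain δ μ) : Measurable (embeddingₗ δ μ f) :=
  (Lp.stronglyMeasurable _).measurable

variable (δ μ)

/-- The form inner product `⟪f, g⟫ + form f g`. -/
@[reducible]
def formCore : InnerProductSpace.Core ℝ (FormDomain δ μ) where
  inner f g := inner ℝ (embeddingₗ δ μ f) (embeddingₗ δ μ g) +
    form δ μ (embeddingₗ δ μ f) (embeddingₗ δ μ g)
  conj_inner_symm f g := by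
    simp only [conj_trivial]
    rw [real_inner_comm, form_comm]
  re_inner_nonneg f := by
    simp only [RCLike.re_to_real]
    rw [form_self_eq (measurable_coe f) (energy_lt_top f)]
    exact add_nonneg real_inner_self_nonneg (by positivity)
  add_left f g h := by
    rw [map_add, inner_add_left, form_congr (Lp.coeFn_add _ _) (ae_eq_refl _),
      form_add_left (measurable_coe f) (measurable_coe g) (measurable_coe h)
        (energy_lt_top f) (energy_lt_top g) (energy_lt_top h)]
    ring
  smul_left f g c := by
    simp only [conj_trivial]
    rw [map_smul, real_inner_smul_left, form_congr (Lp.coeFn_smul _ _) (ae_eq_refl _),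
      form_smul_left]
    ring
  definite f h := by
    rw [form_self_eq (measurable_coe f) (energy_lt_top f)] at h
    have h1 : 0 ≤ 1 / 2 * (energy δ μ (embeddingₗ δ μ f)).toReal := by positivity
    have h2 : (0 : ℝ) ≤ inner ℝ (embeddingₗ δ μ f) (embeddingₗ δ μ f) := real_inner_self_nonneg
    have h3 : inner ℝ (embeddingₗ δ μ f) (embeddingₗ δ μ f) = (0 : ℝ) := by linarith
    exact embeddingₗ_injective (by rw [inner_self_eq_zero.1 h3, map_zero])

instance : NormedAddCommGroup (FormDomain δ μ) :=
  (formCore δ μ).toNormedAddCommGroup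

instance : InnerProductSpace ℝ (FormDomain δ μ) :=
  InnerProductSpace.ofCore (formCore δ μ).toCore

variable {δ μ}

theorem inner_formDomain (f g : FormDomain δ μ) :
    inner ℝ f g = inner ℝ (embeddingₗ δ μ f) (embeddingₗ δ μ g) +
      form δ μ (embeddingₗ δ μ f) (embeddingₗ δ μ g) := rfl

theorem norm_sq_formDomain (f : FormDomain δ μ) :
    ‖f‖ ^ 2 = ‖embeddingₗ δ μ f‖ ^ 2 + 1 / 2 * (energy δ μ (embeddingₗ δ μ f)).toReal := by
  rw [← real_inner_self_eq_norm_sq, inner_formDomain, real_inner_self_eq_norm_sq,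
    form_self_eq (measurable_coe f) (energy_lt_top f)]

theorem norm_embeddingₗ_le (f : FormDomain δ μ) : ‖embeddingₗ δ μ f‖ ≤ ‖f‖ := by
  refine le_of_sq_le_sq ?_ (norm_nonneg f)
  rw [norm_sq_formDomain f]
  exact le_add_of_nonneg_right (by positivity)

variable (δ μ)

/-- The embedding of the form domain into `L²(X, μ)`, as a bounded operator. -/
def embedding : FormDomain δ μ →L[ℝ] Lp ℝ 2 μ :=
  (embeddingₗ δ μ).mkContinuous 1 fun f => by simpa using norm_embeddingₗ_le f

variable {δ μ}

theorem energy_le_liminf {u : ℕ → X → ℝ} {f : X → ℝ} (hu : ∀ n, Measurable (u n))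
    (hf : Measurable f) (h : ∀ᵐ x ∂μ, Tendsto (fun n => u n x) atTop (nhds (f x))) :
    energy δ μ f ≤ liminf (fun n => energy δ μ (u n)) atTop := by
  simp_rw [fun n => energy_eq_prod (δ := δ) (μ := μ) (hu n), energy_eq_prod hf]
  refine le_trans (le_of_eq ?_)
    (lintegral_liminf_le fun n => (measurable_density (hu n) (hu n)).ennreal_ofReal)
  refine lintegral_congr_ae ?_
  filter_upwards [ae_prod_fst h, ae_prod_snd h] with p h1 h2
  exact (((ENNReal.continuous_ofReal.tendsto _).comp
    (((h1.sub h2).mul (h1.sub h2)).div_const _)).liminf_eq).symm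

/-- The form is closed. -/
instance : CompleteSpace (FormDomain δ μ) := by
  refine Metric.complete_of_cauchySeq_tendsto fun u hu => ?_
  have hJ : CauchySeq fun n => embedding δ μ (u n) :=
    (embedding δ μ).uniformContinuous.comp_cauchySeq hu
  obtain ⟨f, hf⟩ := cauchySeq_tendsto_of_complete hJ
  obtain ⟨ns, hns, hae⟩ := (tendstoInMeasure_of_tendsto_Lp hf).exists_seq_tendsto_ae
  have hmf : Measurable f := (Lp.stronglyMeasurable f).measurable
  -- Fatou's lemma bounds the energy of the difference with the limit
  have hE : ∀ ε : ℝ, 0 < ε → ∀ᶠ n in atTop,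
      energy δ μ ((embedding δ μ (u n) - f : Lp ℝ 2 μ) : X → ℝ) ≤ ENNReal.ofReal ε := by
    intro ε hε
    obtain ⟨N, hN⟩ := Metric.cauchySeq_iff.1 hu (Real.sqrt (ε / 2)) (Real.sqrt_pos.2 (by linarith))
    filter_upwards [eventually_ge_atTop N] with n hn
    have hlim : ∀ᵐ x ∂μ, Tendsto
        (fun k => (embedding δ μ (u n - u (ns k)) : X → ℝ) x) atTop
        (nhds (((embedding δ μ (u n) - f : Lp ℝ 2 μ) : X → ℝ) x)) := by
      have hsub : ∀ᵐ x ∂μ, ∀ k, (embedding δ μ (u n - u (ns k)) : X → ℝ) x =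
          (embedding δ μ (u n) : X → ℝ) x - (embedding δ μ (u (ns k)) : X → ℝ) x := by
        rw [ae_all_iff]
        intro k
        rw [map_sub]
        exact Lp.coeFn_sub _ _
      filter_upwards [hae, hsub, Lp.coeFn_sub (embedding δ μ (u n)) f] with x hx hx1 hx2
      simp only [hx1, hx2, Pi.sub_apply]
      exact tendsto_const_nhds.sub hx
    refine (energy_le_liminf (fun k => measurable_coe (u n - u (ns k)))
      (Lp.stronglyMeasurable _).measurable hlim).trans ?_
    refine liminf_le_of_frequently_le' (Eventually.frequently ?_)
    filter_upwards [hns.tendsto_atTop.eventually_ge_atTop N] with k hk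
    have h1 : ‖u n - u (ns k)‖ < Real.sqrt (ε / 2) := by
      rw [← dist_eq_norm]
      exact hN n hn _ hk
    have h2 : ‖u n - u (ns k)‖ ^ 2 < ε / 2 := by
      have := pow_lt_pow_left₀ h1 (norm_nonneg _) two_ne_zero
      rwa [Real.sq_sqrt (by linarith)] at this
    rw [norm_sq_formDomain] at h2
    have h3 : (energy δ μ (embeddingₗ δ μ (u n - u (ns k)))).toReal ≤ ε := by
      nlinarith [sq_nonneg ‖embeddingₗ δ μ (u n - u (ns k))‖]
    exact (ENNReal.le_ofReal_iff_toReal_le (energy_lt_top _).ne hε.le).2 h3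
  have hmem : f ∈ formDomain δ μ := by
    obtain ⟨n, hn⟩ := (hE 1 one_pos).exists
    have h1 : embedding δ μ (u n) - f ∈ formDomain δ μ :=
      lt_of_le_of_lt hn ENNReal.ofReal_lt_top
    have h2 : embedding δ μ (u n) ∈ formDomain δ μ := (u n).2
    simpa using sub_mem h2 h1
  let f' : FormDomain δ μ := ⟨f, hmem⟩
  refine ⟨f', ?_⟩
  rw [tendsto_iff_norm_sub_tendsto_zero]
  have hsq : Tendsto (fun n => ‖u n - f'‖ ^ 2) atTop (nhds 0) := by
    have e1 : Tendsto (fun n => ‖embedding δ μ (u n) - f‖ ^ 2) atTop (nhds 0) := by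
      have := (tendsto_iff_norm_sub_tendsto_zero.1 hf).pow 2
      simpa using this
    have e2 : Tendsto (fun n => 1 / 2 *
        (energy δ μ ((embedding δ μ (u n) - f : Lp ℝ 2 μ) : X → ℝ)).toReal) atTop (nhds 0) := by
      rw [Metric.tendsto_nhds]
      intro ε hε
      filter_upwards [hE ε hε] with n hn
      have h3 := ENNReal.toReal_le_of_le_ofReal hε.le hn
      have h4 : 0 ≤ 1 / 2 *
        (energy δ μ ((embedding δ μ (u n) - f : Lp ℝ 2 μ) : X → ℝ)).toReal := by positivity
      rw [Real.dist_eq, sub_zero, abs_of_nonneg h4]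
      linarith
    have e3 := e1.add e2
    rw [add_zero] at e3
    refine e3.congr fun n => ?_
    rw [norm_sq_formDomain]
    rfl
  have := hsq.sqrt
  simpa [Real.sqrt_sq (norm_nonneg _)] using this

end Form

/-! ### The logarithmic Dirichlet Laplacian -/

section Operator

variable {X : Type*} [MetricSpace X] [SecondCountableTopology X] [MeasurableSpace X] [BorelSpace X]
  (δ : ℝ) (μ : Measure X) [IsFiniteMeasure μ]

/-- The bounded operator `R : L²(X, μ) → L²(X, μ)` with values in the form domain that is given
by `⟪f, g⟫ = ⟪R f, g⟫ + form (R f) g` for all `g` in the form domain: the Hilbert space adjoint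
of the embedding `J` of the form domain, followed by `J`. -/
def formResolvent : Lp ℝ 2 μ →L[ℝ] Lp ℝ 2 μ :=
  embedding δ μ ∘L ContinuousLinearMap.adjoint (embedding δ μ)

theorem formResolvent_spec (f : Lp ℝ 2 μ) :
    ∃ u : FormDomain δ μ, embedding δ μ u = formResolvent δ μ f ∧
      ∀ g : FormDomain δ μ, inner ℝ u g = inner ℝ f (embedding δ μ g) :=
  ⟨ContinuousLinearMap.adjoint (embedding δ μ) f, rfl,
    fun _ => ContinuousLinearMap.adjoint_inner_left _ _ _⟩

/-- The logarithmic Dirichlet Laplacian `Δ`: its domain is the range of `R = formResolvent`, and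
`Δ (R f) = f - R f`, that is, `Δ = R⁻¹ - 1`. -/
def laplacian : Lp ℝ 2 μ →ₗ.[ℝ] Lp ℝ 2 μ :=
  (-LinearMap.id : Lp ℝ 2 μ →ₗ[ℝ] Lp ℝ 2 μ) +ᵥ
    ((formResolvent δ μ : Lp ℝ 2 μ →ₗ[ℝ] Lp ℝ 2 μ).toPMap ⊤).inverse

end Operator

/-! ### Resolvents, eigenvalues, singular values -/

section Spectral

variable {E F H : Type*}
  [NormedAddCommGroup E] [InnerProductSpace ℝ E] [CompleteSpace E]
  [NormedAddCommGroup F] [InnerProductSpace ℝ F] [CompleteSpace F]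
  [NormedAddCommGroup H] [InnerProductSpace ℝ H] [CompleteSpace H]

/-- `S = (1 + A)⁻¹`: the bounded operator `S` is the two-sided inverse of
`1 + A : Dom A → H`. -/
def IsOneAddInverse (A : H →ₗ.[ℝ] H) (S : H →L[ℝ] H) : Prop :=
  (∀ u : A.domain, S ((u : H) + A u) = u) ∧ ∀ f : H, ∃ u : A.domain, (u : H) + A u = f

/-- The eigenspace `{u ∈ Dom A : A u = t u}`. -/
def eigenspace (A : H →ₗ.[ℝ] H) (t : ℝ) : Submodule ℝ H :=
  A.graph.comap (LinearMap.id.prod (t • LinearMap.id))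

/-- The `n`-th eigenvalue (`n = 1, 2, …`) of `A` in increasing order, counting multiplicities:
the least `t` such that the eigenvectors with eigenvalue at most `t` span a space of dimension at
least `n`. It is `⊤` if there is no such `t`. -/
def eigenvalue (A : H →ₗ.[ℝ] H) (n : ℕ) : EReal :=
  sInf ((fun t : ℝ => (t : EReal)) ''
    {t : ℝ | (n : Cardinal) ≤ Module.rank ℝ ↥(⨆ r ∈ Set.Iic t, eigenspace A r)})

/-- The `n`-th singular value (`n = 1, 2, …`) of a compact operator `A`: the `n`-th eigenvalue of
`|A| = (A* A)^(1/2)` in decreasing order, counting multiplicities, that is, the largest `s > 0`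
such that the eigenvectors of `|A|` with eigenvalue at least `s` span a space of dimension at
least `n`, and `0` if there is no such `s`. The eigenvectors of `|A|` with eigenvalue `t > 0` are
those of `A* A` with eigenvalue `t ^ 2`. -/
def singularValue (A : E →L[ℝ] F) (n : ℕ) : ℝ :=
  sSup {s : ℝ | 0 < s ∧ (n : Cardinal) ≤ Module.rank ℝ
    ↥(⨆ t ∈ Set.Ici s, Module.End.eigenspace
      ((ContinuousLinearMap.adjoint A ∘L A : E →L[ℝ] E) : E →ₗ[ℝ] E) (t ^ 2))}

variable (H) in
/-- The logarithmic integral ideal: the compact operators `T` on `H` with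
`s_n(T) = O((log n)⁻¹)`. -/
def Li : Set (H →L[ℝ] H) :=
  {T | IsCompactOperator T ∧
    (fun n : ℕ => singularValue T n) =O[atTop] fun n : ℕ => (Real.log n)⁻¹}

end Spectral

end LogLaplacian

end

/-! Everything follows from one counting bound, `IsAhlforsRegular.exists_mul_log_le`: if `n`
functions are orthonormal in `L²` and their squared form norms are at most `Λ`, then `Λ ≥ c log n`
for large `n`.

To prove it, truncate the singular kernel. With `b = r₀ ^ δ`, the dyadic kernel `w_x(y) = ∑_{j<k}
2^j 1{d(x,y)^δ ≤ b 2^(-j)}` satisfies `w_x ≤ 2b / d^δ` off the diagonal and `w_x ≤ 2^k`. Each of its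
`k` scales has mass at least `c b`, because the ball of volume about `b 2^(-j)` carries the weight
`2^j`. Hence the energy density of `f` at `x` controls `∫ w_x(y) (f(x) - f(y))² dμ(y)`, which is at
least `(∫ w_x - 1) f(x)² - (∫ w_x f)²`. Summed over an orthonormal family, the pairings cost at most
`‖w_x‖² ≤ 4^k μ(X)` by Bessel's inequality, whatever the number of functions. Integration in `x`
gives the main term `n (k c b - 1)` and the error `4^k μ(X)²`; the choice `k ≈ log₄ n` makes the
error at most proportional to `n`, and division by `n` leaves growth of order `k`.

The operator statements reduce to this bound since `R = J J*`. Eigenvectors of `J* J` with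
eigenvalues at least `s` span a space on which `‖g‖² ≤ s⁻¹ ‖J g‖²`, so their number is controlled.
The eigenvalue `t` of `Δ` corresponds to `(1 + t)⁻¹` for `R` and hence for `J* J`. The upper volume
bound serves only to make the form domain dense, through Lipschitz functions; density makes `R`
injective, so that `Δ = R⁻¹ - 1` makes sense. -/

namespace LogLaplacian

/-! ### Compactness, singular values and eigenvalue counts from orthonormal images. -/

section HilbertSpace

variable {E H : Type*}
  [NormedAddCommGroup E] [InnerProductSpace ℝ E]
  [NormedAddCommGroup H] [InnerProductSpace ℝ H]

/-- If `J` is bounded below on a space of dimension at least `n`, then that space contains `n`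
vectors of controlled norm with orthonormal images. -/
theorem exists_orthonormal_of_le_rank (J : E →L[ℝ] H) (W : Submodule ℝ E) {n : ℕ}
    (hn : (n : Cardinal) ≤ Module.rank ℝ W) {Λ : ℝ} (hW : ∀ g ∈ W, ‖g‖ ^ 2 ≤ Λ * ‖J g‖ ^ 2) :
    ∃ g : Fin n → E, Orthonormal ℝ (fun i => J (g i)) ∧ ∀ i, ‖g i‖ ^ 2 ≤ Λ := by
  obtain ⟨v, hv⟩ := Module.le_rank_iff.1 hn
  -- The bound makes `J` injective on `W`, so independent vectors keep independent images; an
  -- orthonormal basis of the span of the images is then pulled back to `W`.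
  have hinj : LinearMap.ker ((J : E →ₗ[ℝ] H) ∘ₗ W.subtype) = ⊥ := by
    rw [LinearMap.ker_eq_bot']
    intro g hg
    have h1 := hW g g.2
    have h2 : J g = 0 := hg
    rw [h2] at h1
    simpa using h1
  have hv' := hv.map' _ hinj
  set U := Submodule.span ℝ (Set.range (((J : E →ₗ[ℝ] H) ∘ₗ W.subtype) ∘ v)) with hU
  have hfin : FiniteDimensional ℝ U := FiniteDimensional.span_of_finite ℝ (Set.finite_range _)
  have hrank : Module.finrank ℝ U = n := by
    exact (finrank_span_eq_card hv').trans (Fintype.card_fin n)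
  let b := (stdOrthonormalBasis ℝ U).reindex (finCongr hrank)
  have hb : ∀ i, ∃ g ∈ W, J g = b i := by
    intro i
    have h1 : (b i : H) ∈ U := (b i).2
    have h2 : U ≤ LinearMap.range ((J : E →ₗ[ℝ] H) ∘ₗ W.subtype) := by
      rw [hU, Submodule.span_le]
      rintro _ ⟨j, rfl⟩
      exact ⟨v j, rfl⟩
    obtain ⟨g, hg⟩ := h2 h1
    exact ⟨g, g.2, hg⟩
  choose g hgW hg using hb
  have hon : Orthonormal ℝ (fun i => J (g i)) := by
    have h := b.orthonormal.comp_linearIsometry U.subtypeₗᵢ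
    convert h using 1
    funext i
    exact hg i
  refine ⟨g, hon, fun i => ?_⟩
  have h := hW _ (hgW i)
  rwa [hon.norm_eq_one i, one_pow, mul_one] at h

/-- On the span of the eigenspaces of a symmetric operator with eigenvalues at least `s`, its
quadratic form is at least `s`. -/
theorem mul_norm_sq_le_inner_of_mem_iSup_eigenspace {B : E →ₗ[ℝ] E} (hB : B.IsSymmetric) (s : ℝ)
    {f : E} (hf : f ∈ ⨆ t ∈ Set.Ici s, Module.End.eigenspace B t) :
    s * ‖f‖ ^ 2 ≤ inner ℝ (B f) f := by
  classical
  have horth : OrthogonalFamily ℝ (fun t : Set.Ici s => Module.End.eigenspace B (t : ℝ))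
      fun t => (Module.End.eigenspace B (t : ℝ)).subtypeₗᵢ :=
    hB.orthogonalFamily_eigenspaces.comp Subtype.coe_injective
  rw [iSup_subtype', Submodule.mem_iSup_iff_exists_dfinsupp'] at hf
  obtain ⟨v, rfl⟩ := hf
  have h1 : (v.sum fun _ x => (x : E)) =
      ∑ i ∈ v.support, (Module.End.eigenspace B (i : ℝ)).subtypeₗᵢ (v i) := rfl
  have h2 : B (∑ i ∈ v.support, (Module.End.eigenspace B (i : ℝ)).subtypeₗᵢ (v i)) =
      ∑ i ∈ v.support, (Module.End.eigenspace B (i : ℝ)).subtypeₗᵢ ((i : ℝ) • v i) := by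
    rw [map_sum]
    refine Finset.sum_congr rfl fun i _ => ?_
    exact Module.End.mem_eigenspace_iff.1 (v i).2
  -- Orthogonality of the eigenspaces removes the cross terms, leaving a comparison of `s` with each
  -- eigenvalue `i ≥ s`.
  rw [h1, h2, horth.inner_sum, ← real_inner_self_eq_norm_sq, horth.inner_sum, Finset.mul_sum]
  refine Finset.sum_le_sum fun i _ => ?_
  rw [real_inner_smul_left]
  exact mul_le_mul_of_nonneg_right i.2 real_inner_self_nonneg

variable [CompleteSpace E] [CompleteSpace H]

theorem isSymmetric_adjoint_comp_self (J : E →L[ℝ] H) :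
    ((ContinuousLinearMap.adjoint J ∘L J : E →L[ℝ] E) : E →ₗ[ℝ] E).IsSymmetric := by
  intro x y
  simp [ContinuousLinearMap.adjoint_inner_left, ContinuousLinearMap.adjoint_inner_right]

/-- An operator `J` is compact if, for each `Λ`, there is a bound on the number of vectors of
squared norm at most `Λ` with orthonormal images. -/
theorem isCompactOperator_of_orthonormal_bound (J : E →L[ℝ] H)
    (hJ : ∀ Λ : ℝ, ∃ N : ℕ, ∀ g : Fin N → E, Orthonormal ℝ (fun i => J (g i)) →
      ¬ ∀ i, ‖g i‖ ^ 2 ≤ Λ) :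
    IsCompactOperator J := by
  have key : ∀ k : ℕ, ∃ F : E →L[ℝ] H, IsCompactOperator F ∧ ‖J - F‖ ≤ 1 / ((k : ℝ) + 1) := by
    intro k
    have hk : (0 : ℝ) < (k : ℝ) + 1 := by positivity
    classical
    have hex := hJ (((k : ℝ) + 1) ^ 2)
    -- The least excluded size is not `0`, since the empty family is admissible. So it is `m + 1`,
    -- and some admissible `g` of size `m` cannot be extended.
    have hmin := Nat.find_spec hex
    obtain ⟨m, hm⟩ : ∃ m, Nat.find hex = m + 1 := by
      refine Nat.exists_eq_succ_of_ne_zero fun h0 => ?_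
      rw [h0] at hmin
      exact hmin Fin.elim0 (Orthonormal.of_isEmpty _) (fun i => i.elim0)
    rw [hm] at hmin
    have hlt := Nat.find_min hex (m := m) (by omega)
    push Not at hlt
    obtain ⟨g, hg, hgΛ⟩ := hlt
    let U : Submodule ℝ E :=
      Submodule.span ℝ (Set.range fun i => ContinuousLinearMap.adjoint J (J (g i)))
    have : FiniteDimensional ℝ U := FiniteDimensional.span_of_finite ℝ (Set.finite_range _)
    -- If `u` is orthogonal to every `J* J gᵢ`, then `J u` is orthogonal to every `J gᵢ`; were the
    -- inequality false, `u / ‖J u‖` would extend the family `g`.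
    have hperp : ∀ u ∈ Uᗮ, ((k : ℝ) + 1) * ‖J u‖ ≤ ‖u‖ := by
      intro u hu
      by_contra! hcon
      have hJu : 0 < ‖J u‖ := by
        have := (norm_nonneg u).trans_lt hcon
        exact (pos_iff_pos_of_mul_pos this).1 hk
      refine hmin (Matrix.vecCons (‖J u‖⁻¹ • u) g) ?_ ?_
      · have : (fun i => J (Matrix.vecCons (‖J u‖⁻¹ • u) g i)) =
            Matrix.vecCons (‖J u‖⁻¹ • J u) (fun i => J (g i)) := by
          funext i
          refine Fin.cases ?_ (fun j => ?_) i <;> simp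
        rw [this, orthonormal_vecCons_iff]
        refine ⟨?_, fun i => ?_, hg⟩
        · rw [norm_smul, norm_inv, norm_norm, inv_mul_cancel₀ hJu.ne']
        · rw [real_inner_smul_left, ← ContinuousLinearMap.adjoint_inner_right,
            (Submodule.mem_orthogonal' _ _).1 hu _ (Submodule.subset_span ⟨i, rfl⟩), mul_zero]
      · intro i
        refine Fin.cases ?_ (fun j => ?_) i
        · rw [Matrix.cons_val_zero, norm_smul, norm_inv, norm_norm]
          refine pow_le_pow_left₀ (by positivity) ?_ 2
          rw [inv_mul_le_iff₀ hJu, mul_comm]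
          exact hcon.le
        · simpa using hgΛ j
    refine ⟨J ∘L U.starProjection, ?_, ?_⟩
    · have h1 : IsCompactOperator (J ∘L U.subtypeL) :=
        isCompactOperator_of_locallyCompactSpace_rng (J ∘L U.subtypeL)
      exact h1.comp_clm U.orthogonalProjectionOnto
    · refine ContinuousLinearMap.opNorm_le_bound _ (by positivity) fun x => ?_
      have h1 := hperp _ (U.sub_starProjection_mem_orthogonal x)
      have h2 : ‖x - U.starProjection x‖ ≤ ‖x‖ := by
        rw [← Submodule.starProjection_orthogonal_val]
        exact Uᗮ.norm_starProjection_apply_le x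
      have h3 : (J - J ∘L U.starProjection) x = J (x - U.starProjection x) := by simp
      rw [h3, one_div, ← div_eq_inv_mul, le_div_iff₀ hk, mul_comm]
      exact h1.trans h2
  choose F hF hFJ using key
  refine isCompactOperator_of_tendsto (l := atTop) (F := F) ?_ (Eventually.of_forall hF)
  rw [tendsto_iff_norm_sub_tendsto_zero]
  refine squeeze_zero (fun _ => norm_nonneg _) (fun k => ?_) tendsto_one_div_add_atTop_nhds_zero_nat
  rw [norm_sub_rev]
  exact hFJ k

/-- An eigenvector of `J J*` with a nonzero eigenvalue is the image of an eigenvector of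
`J* J`. -/
theorem mem_map_eigenspace_adjoint_comp_self (J : E →L[ℝ] H) {f : H} {t : ℝ} (ht : t ≠ 0)
    (hf : J (ContinuousLinearMap.adjoint J f) = t • f) :
    f ∈ (Module.End.eigenspace
      ((ContinuousLinearMap.adjoint J ∘L J : E →L[ℝ] E) : E →ₗ[ℝ] E) t).map (J : E →ₗ[ℝ] H) := by
  refine ⟨t⁻¹ • ContinuousLinearMap.adjoint J f, ?_, ?_⟩
  · rw [SetLike.mem_coe, Module.End.mem_eigenspace_iff]
    simp [hf, ht]
  · simp [hf, ht]

/-- The dimension of a space is at most that of the span of the eigenvectors of `J* J` with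
eigenvalues at least `s` if `J` maps the latter space onto a superset of the former. -/
theorem rank_le_of_le_map_iSup_eigenspace (J : E →L[ℝ] H) {s : ℝ} {W : Submodule ℝ H}
    (hW : W ≤ (⨆ t ∈ Set.Ici s, Module.End.eigenspace
      ((ContinuousLinearMap.adjoint J ∘L J : E →L[ℝ] E) : E →ₗ[ℝ] E) t).map (J : E →ₗ[ℝ] H))
    {n : ℕ} (hn : (n : Cardinal) ≤ Module.rank ℝ W) :
    (n : Cardinal) ≤ Module.rank ℝ ↥(⨆ t ∈ Set.Ici s, Module.End.eigenspace
      ((ContinuousLinearMap.adjoint J ∘L J : E →L[ℝ] E) : E →ₗ[ℝ] E) t) := by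
  have h1 := hn.trans (Submodule.rank_mono hW)
  have h2 := lift_rank_map_le (J : E →ₗ[ℝ] H) (⨆ t ∈ Set.Ici s, Module.End.eigenspace
      ((ContinuousLinearMap.adjoint J ∘L J : E →L[ℝ] E) : E →ₗ[ℝ] E) t)
  have h3 := (Cardinal.lift_le.2 h1).trans h2
  simpa using h3

/-- If `J* J` has `n` eigenvalues above `s`, counted with multiplicity, then a lower bound for the
squared norms of `n` vectors with orthonormal images is one for `s⁻¹`. -/
theorem le_inv_of_le_rank_iSup_eigenspace (J : E →L[ℝ] H) {a : ℝ} {n : ℕ}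
    (hJ : ∀ (Λ : ℝ) (g : Fin n → E), Orthonormal ℝ (fun i => J (g i)) → (∀ i, ‖g i‖ ^ 2 ≤ Λ) →
      a ≤ Λ) {s : ℝ} (hs : 0 < s)
    (hn : (n : Cardinal) ≤ Module.rank ℝ ↥(⨆ t ∈ Set.Ici s, Module.End.eigenspace
      ((ContinuousLinearMap.adjoint J ∘L J : E →L[ℝ] E) : E →ₗ[ℝ] E) t)) : a ≤ s⁻¹ := by
  obtain ⟨g, hg, hgΛ⟩ := exists_orthonormal_of_le_rank J _ hn (Λ := s⁻¹) fun g hg => by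
    have h := mul_norm_sq_le_inner_of_mem_iSup_eigenspace (isSymmetric_adjoint_comp_self J) s hg
    have h2 : inner ℝ ((ContinuousLinearMap.adjoint J ∘L J : E →L[ℝ] E) g) g = ‖J g‖ ^ 2 := by
      simp [ContinuousLinearMap.adjoint_inner_left]
    rw [← div_eq_inv_mul, le_div_iff₀ hs, mul_comm, ← h2]
    exact h
  exact hJ _ g hg hgΛ

theorem singularValue_nonneg (A : E →L[ℝ] H) (n : ℕ) : 0 ≤ singularValue A n :=
  Real.sSup_nonneg fun _ hs => hs.1.le

/-- The bound of `le_inv_of_le_rank_iSup_eigenspace` for the singular values of `J`. -/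
theorem singularValue_sq_le_inv (J : E →L[ℝ] H) {a : ℝ} (ha : 0 < a) {n : ℕ}
    (hJ : ∀ (Λ : ℝ) (g : Fin n → E), Orthonormal ℝ (fun i => J (g i)) → (∀ i, ‖g i‖ ^ 2 ≤ Λ) →
      a ≤ Λ) : singularValue J n ≤ a ^ (-(1 / 2) : ℝ) := by
  -- The nonnegativity of the bound covers the empty set, whose real supremum is `0`.
  refine Real.sSup_le (fun s ⟨hs, hn⟩ => ?_) (by positivity)
  have h1 : (⨆ t ∈ Set.Ici s, Module.End.eigenspace
      ((ContinuousLinearMap.adjoint J ∘L J : E →L[ℝ] E) : E →ₗ[ℝ] E) (t ^ 2)) ≤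
      ⨆ t ∈ Set.Ici (s ^ 2), Module.End.eigenspace
      ((ContinuousLinearMap.adjoint J ∘L J : E →L[ℝ] E) : E →ₗ[ℝ] E) t :=
    iSup₂_le fun t ht => le_iSup₂_of_le (t ^ 2) (pow_le_pow_left₀ hs.le ht 2) le_rfl
  have h2 := le_inv_of_le_rank_iSup_eigenspace J hJ (by positivity)
    (hn.trans (Submodule.rank_mono h1))
  rw [Real.rpow_neg ha.le, ← Real.sqrt_eq_rpow]
  rw [le_inv_comm₀ ha (by positivity)] at h2
  rw [← Real.sqrt_inv]
  exact Real.le_sqrt_of_sq_le h2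

/-- The bound of `le_inv_of_le_rank_iSup_eigenspace` for the singular values of `J J*`. -/
theorem singularValue_comp_adjoint_le_inv (J : E →L[ℝ] H) {a : ℝ} (ha : 0 < a) {n : ℕ}
    (hJ : ∀ (Λ : ℝ) (g : Fin n → E), Orthonormal ℝ (fun i => J (g i)) → (∀ i, ‖g i‖ ^ 2 ≤ Λ) →
      a ≤ Λ) : singularValue (J ∘L ContinuousLinearMap.adjoint J) n ≤ a⁻¹ := by
  refine Real.sSup_le (fun s ⟨hs, hn⟩ => ?_) (by positivity)
  rw [le_inv_comm₀ hs ha]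
  refine le_inv_of_le_rank_iSup_eigenspace J hJ hs (rank_le_of_le_map_iSup_eigenspace J ?_ hn)
  refine iSup₂_le fun t ht f hf => ?_
  have ht0 : 0 < t := hs.trans_le ht
  refine Submodule.map_mono (le_iSup₂_of_le t ht le_rfl)
    (mem_map_eigenspace_adjoint_comp_self J ht0.ne' ?_)
  set B := J ∘L ContinuousLinearMap.adjoint J with hB
  have hf' : ContinuousLinearMap.adjoint B (B f) = t ^ 2 • f := Module.End.mem_eigenspace_iff.1 hf
  have hBadj : ContinuousLinearMap.adjoint B = B := by
    rw [hB, ContinuousLinearMap.adjoint_comp, ContinuousLinearMap.adjoint_adjoint]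
  rw [hBadj] at hf'
  -- `(B + t) (B - t) f = 0`, and `B + t` is positive definite
  have h1 : B (B f - t • f) = -t • (B f - t • f) := by
    rw [map_sub, map_smul, hf', smul_sub, smul_smul]
    module
  have h2 : inner ℝ (B (B f - t • f)) (B f - t • f) =
      ‖ContinuousLinearMap.adjoint J (B f - t • f)‖ ^ 2 := by
    rw [hB, ContinuousLinearMap.comp_apply, ← ContinuousLinearMap.adjoint_inner_right,
      real_inner_self_eq_norm_sq]
  rw [h1, real_inner_smul_left, real_inner_self_eq_norm_sq] at h2
  have h3 : ‖B f - t • f‖ ^ 2 = 0 := by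
    refine le_antisymm ?_ (sq_nonneg _)
    by_contra! hcon
    nlinarith [mul_pos ht0 hcon, sq_nonneg ‖ContinuousLinearMap.adjoint J (B f - t • f)‖]
  exact sub_eq_zero.1 (norm_eq_zero.1 (pow_eq_zero_iff two_ne_zero |>.1 h3))

end HilbertSpace

end LogLaplacian

namespace LogLaplacian

/-! ### Lower volume bound at small scales. -/

section SmallBalls

variable {X : Type*} [MetricSpace X] [MeasurableSpace X] {δ : ℝ} {μ : Measure X}

/-- The lower bound for the volume of small balls. It also holds on a one-point space, where
Ahlfors regularity is no condition on `μ`. -/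
theorem IsAhlforsRegular.exists_le_measureReal_closedBall [IsFiniteMeasure μ] (hδ : 0 < δ)
    (h : IsAhlforsRegular δ μ) :
    ∃ c : ℝ, 0 < c ∧ ∃ r₀ : ℝ, 0 < r₀ ∧ ∀ᵐ x ∂μ, ∀ r : ℝ, 0 ≤ r → r ≤ r₀ →
      c * r ^ δ ≤ μ.real (Metric.closedBall x r) := by
  rcases eq_or_ne μ 0 with rfl | hμ
  · exact ⟨1, one_pos, 1, one_pos, by simp⟩
  rcases eq_or_ne (Metric.ediam (Set.univ : Set X)) 0 with h0 | h0
  · rw [Metric.ediam_eq_zero_iff] at h0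
    refine ⟨μ.real Set.univ, ?_, 1, one_pos, Eventually.of_forall fun x r hr hr1 => ?_⟩
    · exact ENNReal.toReal_pos (by simpa using hμ) (measure_ne_top _ _)
    · have : Metric.closedBall x r = Set.univ := by
        refine Set.eq_univ_of_forall fun y => ?_
        rw [h0 (Set.mem_univ y) (Set.mem_univ x)]
        exact Metric.mem_closedBall_self hr
      rw [this]
      exact mul_le_of_le_one_right measureReal_nonneg (Real.rpow_le_one hr hr1 hδ.le)
  · obtain ⟨C, hC, hball⟩ := h
    obtain ⟨r₀, -, hr₀, hlt⟩ := ENNReal.lt_iff_exists_real_btwn.1 (pos_iff_ne_zero.2 h0)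
    refine ⟨C⁻¹, by positivity, r₀, ENNReal.ofReal_pos.1 hr₀,
      Eventually.of_forall fun x r hr hrr => ?_⟩
    have h1 := (hball x r hr ((ENNReal.ofReal_le_ofReal hrr).trans_lt hlt)).1
    rwa [ENNReal.ofReal_le_iff_le_toReal (measure_ne_top _ _)] at h1

end SmallBalls

/-! ### The truncated dyadic kernel and its comparison with the energy density. -/

section Kernel

/-- The truncated kernel `∑_{j < k} 2 ^ j 1_{t ≤ b 2 ^ (-j)}`, which is comparable with
`1 / max t (b 2 ^ (-k))`. -/
noncomputable def dyadicKernel (b : ℝ) (k : ℕ) (t : ℝ) : ℝ :=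
  ∑ j ∈ Finset.range k, if t ≤ b * (1 / 2) ^ j then (2 : ℝ) ^ j else 0

theorem dyadicKernel_nonneg (b : ℝ) (k : ℕ) (t : ℝ) : 0 ≤ dyadicKernel b k t :=
  Finset.sum_nonneg fun j _ => by split_ifs <;> positivity

theorem dyadicKernel_succ (b : ℝ) (k : ℕ) (t : ℝ) :
    dyadicKernel b (k + 1) t =
      dyadicKernel b k t + if t ≤ b * (1 / 2) ^ k then (2 : ℝ) ^ k else 0 :=
  Finset.sum_range_succ _ _

theorem dyadicKernel_le (b : ℝ) (k : ℕ) (t : ℝ) : dyadicKernel b k t ≤ 2 ^ k := by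
  induction k with
  | zero => simp [dyadicKernel]
  | succ k ih =>
    have h : (if t ≤ b * (1 / 2) ^ k then (2 : ℝ) ^ k else 0) ≤ 2 ^ k := by
      split_ifs
      · exact le_rfl
      · positivity
    rw [dyadicKernel_succ, pow_succ]
    linarith

/-- The last active scale decides: if `t ≤ b 2^(-k)`, the geometric sum is at most `2^(k+1)`;
otherwise the new term vanishes. The bound does not depend on `k`, so truncation costs only a factor
`2b`. -/
theorem dyadicKernel_mul_le {b t : ℝ} (hb : 0 ≤ b) (ht : 0 ≤ t) (k : ℕ) :
    dyadicKernel b k t * t ≤ 2 * b := by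
  induction k with
  | zero => simpa [dyadicKernel] using hb
  | succ k ih =>
    by_cases h : t ≤ b * (1 / 2) ^ k
    · calc dyadicKernel b (k + 1) t * t ≤ 2 ^ (k + 1) * (b * (1 / 2) ^ k) := by
            gcongr
            exact dyadicKernel_le b (k + 1) t
        _ = 2 * b * (2 * (1 / 2)) ^ k := by rw [mul_pow, pow_succ]; ring
        _ = 2 * b := by norm_num
    · rw [dyadicKernel_succ, if_neg h, add_zero]
      exact ih

theorem measurable_dyadicKernel (b : ℝ) (k : ℕ) : Measurable (dyadicKernel b k) :=
  Finset.measurable_fun_sum _ fun _ _ =>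
    Measurable.ite measurableSet_Iic measurable_const measurable_const

variable {X : Type*} [MetricSpace X] [MeasurableSpace X]
  [OpensMeasurableSpace X] {δ : ℝ} {μ : Measure X} [IsFiniteMeasure μ]

theorem measurable_dyadicKernel_dist (δ b : ℝ) (k : ℕ) (x : X) :
    Measurable fun y => dyadicKernel b k (dist x y ^ δ) :=
  (measurable_dyadicKernel b k).comp
    ((continuous_const.dist continuous_id).measurable.pow_const δ)

/-- The total mass of the truncated kernel grows linearly with the number of scales. -/
theorem le_integral_dyadicKernel (hδ : 0 < δ) {c r₀ : ℝ} (hr₀ : 0 < r₀) {x : X}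
    (h : ∀ r : ℝ, 0 ≤ r → r ≤ r₀ → c * r ^ δ ≤ μ.real (Metric.closedBall x r)) (k : ℕ) :
    k * (c * r₀ ^ δ) ≤ ∫ y, dyadicKernel (r₀ ^ δ) k (dist x y ^ δ) ∂μ := by
  have hms : ∀ j : ℕ, MeasurableSet {y : X | dist x y ^ δ ≤ r₀ ^ δ * (1 / 2) ^ j} := fun j =>
    measurableSet_le ((continuous_const.dist continuous_id).measurable.pow_const δ) measurable_const
  have hind : ∀ (j : ℕ) (y : X), (if dist x y ^ δ ≤ r₀ ^ δ * (1 / 2) ^ j then (2 : ℝ) ^ j else 0) =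
      {y : X | dist x y ^ δ ≤ r₀ ^ δ * (1 / 2) ^ j}.indicator (fun _ => (2 : ℝ) ^ j) y :=
    fun j y => by simp [Set.indicator_apply]
  simp only [dyadicKernel, hind]
  rw [integral_finsetSum _ fun j _ => (integrable_const _).indicator (hms j)]
  calc (k : ℝ) * (c * r₀ ^ δ) = ∑ j ∈ Finset.range k, c * r₀ ^ δ := by simp
    _ ≤ _ := Finset.sum_le_sum fun j _ => ?_
  rw [integral_indicator_const _ (hms j), smul_eq_mul]
  -- The radius with `r ^ δ = b 2^(-j)`, where `b = r₀ ^ δ`: the volume bound `c b 2^(-j)` cancels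
  -- the weight `2^j`, so every scale contributes at least `c b`.
  set r : ℝ := (r₀ ^ δ * (1 / 2) ^ j) ^ δ⁻¹ with hr
  have hr0 : 0 ≤ r := by positivity
  have hrδ : r ^ δ = r₀ ^ δ * (1 / 2) ^ j := Real.rpow_inv_rpow (by positivity) hδ.ne'
  have hrr : r ≤ r₀ := by
    rw [← Real.rpow_le_rpow_iff hr0 hr₀.le hδ, hrδ]
    exact mul_le_of_le_one_right (by positivity) (pow_le_one₀ (by norm_num) (by norm_num))
  have hsub : Metric.closedBall x r ⊆ {y : X | dist x y ^ δ ≤ r₀ ^ δ * (1 / 2) ^ j} := by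
    intro y hy
    rw [Metric.mem_closedBall'] at hy
    rw [Set.mem_ofPred_eq, ← hrδ]
    exact Real.rpow_le_rpow dist_nonneg hy hδ.le
  calc c * r₀ ^ δ = c * r ^ δ * 2 ^ j := by
        rw [hrδ, one_div, inv_pow]
        field_simp
    _ ≤ _ := mul_le_mul_of_nonneg_right ((h r hr0 hrr).trans (measureReal_mono hsub))
        (by positivity)

/-- Bessel's inequality for the pairings of an orthonormal family with a bounded function. -/
theorem sum_integral_mul_sq_le {ι : Type*} [Fintype ι] {f : ι → Lp ℝ 2 μ} (hf : Orthonormal ℝ f)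
    {w : X → ℝ} (hw : Measurable w) {M : ℝ} (hM : ∀ y, |w y| ≤ M) :
    ∑ i, (∫ y, w y * f i y ∂μ) ^ 2 ≤ M ^ 2 * μ.real Set.univ := by
  have hmem : MemLp w 2 μ :=
    MemLp.of_bound hw.aestronglyMeasurable M (Eventually.of_forall hM)
  have h1 := hf.sum_inner_products_le (hmem.toLp w) (s := Finset.univ)
  have h2 : ∀ i, inner ℝ (f i) (hmem.toLp w) = ∫ y, w y * f i y ∂μ := by
    intro i
    rw [L2.inner_def]
    refine integral_congr_ae ?_
    filter_upwards [hmem.coeFn_toLp] with y hy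
    simp [hy]
  have h3 : ‖hmem.toLp w‖ ^ 2 ≤ M ^ 2 * μ.real Set.univ := by
    rw [← real_inner_self_eq_norm_sq, L2.inner_def]
    calc ∫ y, inner ℝ (hmem.toLp w y) (hmem.toLp w y) ∂μ = ∫ y, w y ^ 2 ∂μ := by
          refine integral_congr_ae ?_
          filter_upwards [hmem.coeFn_toLp] with y hy
          rw [hy, real_inner_self_eq_norm_sq, Real.norm_eq_abs, sq_abs]
      _ ≤ ∫ _, M ^ 2 ∂μ := by
          refine integral_mono hmem.integrable_sq (integrable_const _) fun y => ?_
          exact sq_le_sq' (abs_le.1 (hM y)).1 (abs_le.1 (hM y)).2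
      _ = _ := by rw [integral_const, smul_eq_mul, mul_comm]
  refine le_trans (le_of_eq ?_) (h1.trans h3)
  refine Finset.sum_congr rfl fun i _ => ?_
  rw [h2, Real.norm_eq_abs, sq_abs]

/-- The density of the energy dominates the square of the function times the mass of the truncated
kernel, up to the pairing of the function with the truncated kernel. -/
theorem mul_sq_sub_sq_le_integral_density {f : X → ℝ} (hf : MemLp f 2 μ) {b : ℝ} (hb : 0 ≤ b)
    (k : ℕ) {x : X}
    (hx : Integrable (fun y => (f x - f y) * (f x - f y) / dist x y ^ δ) μ) :
    ((∫ y, dyadicKernel b k (dist x y ^ δ) ∂μ) - 1) * f x ^ 2 -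
        (∫ y, dyadicKernel b k (dist x y ^ δ) * f y ∂μ) ^ 2 ≤
      2 * b * ∫ y, (f x - f y) * (f x - f y) / dist x y ^ δ ∂μ := by
  set w : X → ℝ := fun y => dyadicKernel b k (dist x y ^ δ) with hw
  have hwm : Measurable w := measurable_dyadicKernel_dist δ b k x
  have hw0 : ∀ y, 0 ≤ w y := fun y => dyadicKernel_nonneg _ _ _
  have hwM : ∀ y, ‖w y‖ ≤ 2 ^ k := fun y => by
    rw [Real.norm_eq_abs, abs_of_nonneg (hw0 y)]
    exact dyadicKernel_le _ _ _
  have i0 : Integrable w μ :=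
    Integrable.of_bound hwm.aestronglyMeasurable _ (Eventually.of_forall hwM)
  have i1 : Integrable (fun y => w y * f y) μ :=
    (hf.integrable one_le_two).bdd_mul hwm.aestronglyMeasurable (Eventually.of_forall hwM)
  have i2 : Integrable (fun y => w y * f y ^ 2) μ :=
    hf.integrable_sq.bdd_mul hwm.aestronglyMeasurable (Eventually.of_forall hwM)
  have i3 : Integrable (fun y => w y * f x ^ 2 - 2 * f x * (w y * f y)) μ :=
    (i0.mul_const _).sub (i1.const_mul _)
  have hle : ∫ y, (w y * f x ^ 2 - 2 * f x * (w y * f y) + w y * f y ^ 2) ∂μ ≤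
      ∫ y, 2 * b * ((f x - f y) * (f x - f y) / dist x y ^ δ) ∂μ := by
    refine integral_mono (i3.add i2) (hx.const_mul _)
      fun y => ?_
    have e : w y * f x ^ 2 - 2 * f x * (w y * f y) + w y * f y ^ 2 = w y * (f x - f y) ^ 2 := by
      ring
    dsimp only
    rw [e]
    have hd : 0 ≤ dist x y ^ δ := Real.rpow_nonneg dist_nonneg _
    rcases hd.eq_or_lt with h0 | h0
    -- On the diagonal the quotient is `0 / 0 = 0`, and the left side vanishes too.
    · have hxy : f x - f y = 0 := by
        have := (Real.rpow_eq_zero_iff_of_nonneg dist_nonneg).1 h0.symm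
        rw [dist_eq_zero.1 this.1, sub_self]
      simp [hxy]
    · rw [← mul_div_assoc, le_div_iff₀ h0]
      have := mul_le_mul_of_nonneg_right (dyadicKernel_mul_le hb hd k) (sq_nonneg (f x - f y))
      linarith
  rw [integral_add i3 i2,
    integral_sub (i0.mul_const _) (i1.const_mul _), integral_mul_const, integral_const_mul,
    integral_const_mul] at hle
  have h2 : 0 ≤ ∫ y, w y * f y ^ 2 ∂μ :=
    integral_nonneg fun y => mul_nonneg (hw0 y) (sq_nonneg _)
  -- The cross term is absorbed by `2 f(x) ∫ w f ≤ f(x)² + (∫ w f)²`; this is the source of the `-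
  -- 1`.
  nlinarith [sq_nonneg (f x - ∫ y, w y * f y ∂μ)]

end Kernel

/-! ### Logarithmic growth of the form norm on orthonormal families. -/

section Growth

variable {X : Type*} [MetricSpace X] [SecondCountableTopology X] [MeasurableSpace X] [BorelSpace X]
  {δ : ℝ} {μ : Measure X} [IsFiniteMeasure μ]

theorem norm_sq_formDomain_eq_integral (g : FormDomain δ μ) :
    ‖g‖ ^ 2 = ‖embedding δ μ g‖ ^ 2 + 1 / 2 * ∫ x, ∫ y, (embedding δ μ g x - embedding δ μ g y) *
      (embedding δ μ g x - embedding δ μ g y) / dist x y ^ δ ∂μ ∂μ := by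
  rw [← real_inner_self_eq_norm_sq, inner_formDomain, real_inner_self_eq_norm_sq]
  rfl

theorem integral_sq_eq_norm_sq (f : Lp ℝ 2 μ) : ∫ x, f x ^ 2 ∂μ = ‖f‖ ^ 2 := by
  rw [← real_inner_self_eq_norm_sq, L2.inner_def]
  simp [sq]

/-- A lower bound for the norm in the form domain of `4 ^ k` functions that are orthonormal in
`L²(X, μ)`. -/
theorem le_of_orthonormal_embedding (hδ : 0 < δ) {c r₀ : ℝ} (hr₀ : 0 < r₀)
    (h : ∀ᵐ x ∂μ, ∀ r : ℝ, 0 ≤ r → r ≤ r₀ → c * r ^ δ ≤ μ.real (Metric.closedBall x r))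
    {n k : ℕ} (hn : 0 < n) (hk : 4 ^ k ≤ n) {g : Fin n → FormDomain δ μ}
    (hg : Orthonormal ℝ fun i => embedding δ μ (g i)) {Λ : ℝ} (hΛ : ∀ i, ‖g i‖ ^ 2 ≤ Λ) :
    k * (c * r₀ ^ δ) - 1 - μ.real Set.univ ^ 2 ≤ 4 * r₀ ^ δ * Λ := by
  set b := r₀ ^ δ with hb
  have hb0 : 0 < b := by positivity
  set f : Fin n → Lp ℝ 2 μ := fun i => embedding δ μ (g i) with hf
  let F : Fin n → X → ℝ := fun i x =>
    ∫ y, (f i x - f i y) * (f i x - f i y) / dist x y ^ δ ∂μ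
  have hint : ∀ i, Integrable (fun p : X × X =>
      (f i p.1 - f i p.2) * (f i p.1 - f i p.2) / dist p.1 p.2 ^ δ) (μ.prod μ) := fun i =>
    integrable_density (measurable_coe (g i)) (measurable_coe (g i)) (energy_lt_top (g i))
      (energy_lt_top (g i))
  have hF : ∀ i, Integrable (F i) μ := fun i => (hint i).integral_prod_left
  have hF2 : ∀ i, ∫ x, F i x ∂μ ≤ 2 * Λ := by
    intro i
    have h1 := hΛ i
    rw [norm_sq_formDomain_eq_integral] at h1
    have h2 : (0 : ℝ) ≤ ‖embedding δ μ (g i)‖ ^ 2 := by positivity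
    change _ + 1 / 2 * ∫ x, F i x ∂μ ≤ _ at h1
    linarith
  have hsq : ∀ i, Integrable (fun x => f i x ^ 2) μ := fun i => (Lp.memLp (f i)).integrable_sq
  set m : ℝ := k * (c * b) with hm
  have hpt : ∀ᵐ x ∂μ, (m - 1) * ∑ i, f i x ^ 2 - 4 ^ k * μ.real Set.univ ≤
      2 * b * ∑ i, F i x := by
    have hslice : ∀ᵐ x ∂μ, ∀ i, Integrable (fun y =>
        (f i x - f i y) * (f i x - f i y) / dist x y ^ δ) μ :=
      ae_all_iff.2 fun i => (hint i).prod_right_ae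
    filter_upwards [h, hslice] with x hx hxs
    have h1 := le_integral_dyadicKernel (μ := μ) hδ hr₀ hx k
    -- Bessel's inequality at fixed `x` bounds all the pairings together, by a quantity independent
    -- of `n`.
    have h2 := sum_integral_mul_sq_le hg (measurable_dyadicKernel_dist δ b k x) (M := 2 ^ k)
      fun y => by
        rw [abs_of_nonneg (dyadicKernel_nonneg _ _ _)]
        exact dyadicKernel_le _ _ _
    have h3 := Finset.sum_le_sum fun i (_ : i ∈ Finset.univ) =>
      mul_sq_sub_sq_le_integral_density (δ := δ) (Lp.memLp (f i)) hb0.le k (hxs i)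
    rw [Finset.sum_sub_distrib, ← Finset.mul_sum, ← Finset.mul_sum] at h3
    have h4 : (m - 1) * ∑ i, f i x ^ 2 ≤
        ((∫ y, dyadicKernel b k (dist x y ^ δ) ∂μ) - 1) * ∑ i, f i x ^ 2 :=
      mul_le_mul_of_nonneg_right (by linarith) (Finset.sum_nonneg fun i _ => sq_nonneg _)
    have h5 : ((2 : ℝ) ^ k) ^ 2 = 4 ^ k := by rw [← pow_mul, mul_comm, pow_mul]; norm_num
    rw [h5] at h2
    linarith
  have hs : Integrable (fun x => (m - 1) * ∑ i, f i x ^ 2) μ :=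
    (integrable_finsetSum _ fun i _ => hsq i).const_mul _
  have hd : Integrable (fun x => (m - 1) * ∑ i, f i x ^ 2 - 4 ^ k * μ.real Set.univ) μ :=
    hs.sub (integrable_const _)
  have hI := integral_mono_ae hd
    ((integrable_finsetSum _ fun i _ => hF i).const_mul _) hpt
  rw [integral_sub hs (integrable_const _),
    integral_const_mul, integral_const, integral_const_mul,
    integral_finsetSum _ fun i _ => hsq i, integral_finsetSum _ fun i _ => hF i] at hI
  have h1 : ∑ i, ∫ x, f i x ^ 2 ∂μ = n := by
    simp_rw [integral_sq_eq_norm_sq, fun i => hg.norm_eq_one i]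
    simp
  have h2 : ∑ i, ∫ x, F i x ∂μ ≤ n * (2 * Λ) := by
    refine (Finset.sum_le_sum fun i _ => hF2 i).trans (by simp)
  rw [h1, smul_eq_mul] at hI
  have hn' : (0 : ℝ) < n := by exact_mod_cast hn
  have hk' : (4 : ℝ) ^ k ≤ n := by exact_mod_cast hk
  have h3 : 2 * b * ∑ i, ∫ x, F i x ∂μ ≤ 2 * b * (n * (2 * Λ)) :=
    mul_le_mul_of_nonneg_left h2 (by positivity)
  -- Here `4 ^ k ≤ n` makes the Bessel error comparable to `n`, hence bounded per function.
  have h4 : μ.real Set.univ * (4 ^ k * μ.real Set.univ) ≤ n * μ.real Set.univ ^ 2 := by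
    nlinarith [sq_nonneg (μ.real Set.univ)]
  have h5 : n * (m - 1 - μ.real Set.univ ^ 2) ≤ n * (4 * b * Λ) := by linarith
  exact le_of_mul_le_mul_left h5 hn'

/-- Among the functions in a ball of the form domain, at most exponentially many in the radius
squared are orthonormal in `L²(X, μ)`. -/
theorem IsAhlforsRegular.exists_mul_log_le (hδ : 0 < δ) (hμ : IsAhlforsRegular δ μ) :
    ∃ c : ℝ, 0 < c ∧ ∀ᶠ n : ℕ in atTop, ∀ (Λ : ℝ) (g : Fin n → FormDomain δ μ),
      Orthonormal ℝ (fun i => embedding δ μ (g i)) → (∀ i, ‖g i‖ ^ 2 ≤ Λ) →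
        c * Real.log n ≤ Λ := by
  obtain ⟨c, hc, r₀, hr₀, hball⟩ := hμ.exists_le_measureReal_closedBall hδ
  set b := r₀ ^ δ with hb
  have hb0 : 0 < b := by positivity
  have h4 : 0 < Real.log 4 := Real.log_pos (by norm_num)
  -- With `k = Nat.log 4 n > log n / log 4 - 1`, half of `c b log n / log 4` absorbs the constants
  -- for large `n`; the other half is divided by `4 b`.
  refine ⟨c / (8 * Real.log 4), by positivity, ?_⟩
  have hlog : Tendsto (fun n : ℕ => c * b / (2 * Real.log 4) * Real.log n) atTop atTop :=
    (Real.tendsto_log_atTop.comp tendsto_natCast_atTop_atTop).const_mul_atTop (by positivity)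
  filter_upwards [eventually_gt_atTop 0,
    hlog.eventually_ge_atTop (c * b + 1 + μ.real Set.univ ^ 2)] with n hn hbig Λ g hg hΛ
  have h1 := le_of_orthonormal_embedding hδ hr₀ hball hn (Nat.pow_log_le_self 4 hn.ne') hg hΛ
  have h2 : Real.log n ≤ ((Nat.log 4 n : ℕ) + 1) * Real.log 4 := by
    have : (n : ℝ) ≤ 4 ^ (Nat.log 4 n + 1) := by
      exact_mod_cast (Nat.lt_pow_succ_log_self (by norm_num) n).le
    have h := Real.log_le_log (by exact_mod_cast hn) this
    rw [Real.log_pow] at h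
    exact_mod_cast h
  have h3 : Real.log n / Real.log 4 ≤ (Nat.log 4 n : ℕ) + 1 := by rwa [div_le_iff₀ h4]
  have h5 : c * b * (Real.log n / Real.log 4) ≤ c * b * ((Nat.log 4 n : ℕ) + 1) :=
    mul_le_mul_of_nonneg_left h3 (by positivity)
  have h6 : c * b / (2 * Real.log 4) * Real.log n = c * b * (Real.log n / Real.log 4) / 2 := by
    field_simp
  rw [h6] at hbig
  have h7 : 4 * b * (c / (8 * Real.log 4) * Real.log n) =
      c * b * (Real.log n / Real.log 4) / 2 := by
    field_simp
    ring
  refine le_of_mul_le_mul_left (a := 4 * b) ?_ (by positivity)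
  rw [h7]
  linarith

end Growth

end LogLaplacian

namespace LogLaplacian

/-! ### Finite energy of bounded Lipschitz functions, and density of the form domain. -/

section Density

variable {X : Type*} [MetricSpace X] [MeasurableSpace X] {δ : ℝ} {μ : Measure X}

/-- The upper bound for the volume of balls, for all radii. -/
theorem IsAhlforsRegular.exists_measure_closedBall_le [IsFiniteMeasure μ] (hδ : 0 < δ)
    (h : IsAhlforsRegular δ μ) (h0 : Metric.ediam (Set.univ : Set X) ≠ 0) :
    ∃ C : ℝ, 0 < C ∧ ∀ (x : X) (r : ℝ), 0 ≤ r →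
      μ (Metric.closedBall x r) ≤ ENNReal.ofReal (C * r ^ δ) := by
  obtain ⟨C, hC, hball⟩ := h
  have hC0 : 0 < C := by linarith
  set d := (Metric.ediam (Set.univ : Set X)).toReal with hd
  -- The second entry handles radii beyond the diameter, where the total mass is the bound. If the
  -- diameter is infinite, then `d = 0` and that case does not arise.
  refine ⟨max C (μ.real Set.univ / d ^ δ), lt_max_of_lt_left hC0, fun x r hr => ?_⟩
  have hrδ : 0 ≤ r ^ δ := Real.rpow_nonneg hr _
  rcases lt_or_ge (ENNReal.ofReal r) (Metric.ediam (Set.univ : Set X)) with hlt | hge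
  · exact (hball x r hr hlt).2.trans (ENNReal.ofReal_le_ofReal
      (mul_le_mul_of_nonneg_right (le_max_left _ _) hrδ))
  · have hfin : Metric.ediam (Set.univ : Set X) ≠ ∞ := ne_top_of_le_ne_top ENNReal.ofReal_ne_top hge
    have hd0 : 0 < d := ENNReal.toReal_pos h0 hfin
    have hdr : d ≤ r := ENNReal.toReal_le_of_le_ofReal hr hge
    have hdδ : 0 < d ^ δ := Real.rpow_pos_of_pos hd0 _
    refine (measure_mono (Set.subset_univ _)).trans ?_
    rw [← ofReal_measureReal]
    refine ENNReal.ofReal_le_ofReal ?_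
    calc μ.real Set.univ = μ.real Set.univ / d ^ δ * d ^ δ := by field_simp
      _ ≤ _ := mul_le_mul (le_max_right _ _) (Real.rpow_le_rpow hd0.le hdr hδ.le) hdδ.le
          (hC0.le.trans (le_max_left _ _))

/-- Pointwise bound of the energy density of a bounded Lipschitz function by a sum over dyadic
scales. -/
theorem ofReal_density_le_tsum (hδ : 0 < δ) {f : X → ℝ} {L : ℝ}
    (hf : ∀ x y, |f x - f y| ≤ 1) (hL : ∀ x y, |f x - f y| ≤ L * dist x y) (x y : X) :
    ENNReal.ofReal (|f x - f y| ^ 2 / dist x y ^ δ) ≤ 1 +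
      ∑' j : ℕ, (Metric.closedBall x ((1 / 2 : ℝ) ^ j)).indicator (fun _ => ENNReal.ofReal
        (L ^ 2 * ((1 / 2) ^ j) ^ 2 / ((1 / 2 : ℝ) ^ (j + 1)) ^ δ)) y := by
  rcases (dist_nonneg (x := x) (y := y)).eq_or_lt with h0 | h0
  · rw [dist_eq_zero.1 h0.symm]
    simp
  rcases lt_or_ge 1 (dist x y) with h1 | h1
  · refine le_add_right ?_
    rw [← ENNReal.ofReal_one]
    refine ENNReal.ofReal_le_ofReal ?_
    exact div_le_one_of_le₀ ((pow_le_one₀ (abs_nonneg _) (hf x y)).trans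
      (Real.one_le_rpow h1.le hδ.le)) (by positivity)
  -- The dyadic annulus `2^(-(j+1)) < d(x,y) ≤ 2^(-j)`.
  · obtain ⟨j, hj, hj'⟩ := exists_nat_pow_near_of_lt_one h0 h1 (y := (1 / 2 : ℝ)) (by norm_num)
      (by norm_num)
    refine le_add_left (le_trans ?_ (ENNReal.le_tsum j))
    rw [Set.indicator_of_mem (by rwa [Metric.mem_closedBall'])]
    refine ENNReal.ofReal_le_ofReal ?_
    refine div_le_div₀ (by positivity) ?_ (by positivity)
      (Real.rpow_le_rpow (by positivity) hj.le hδ.le)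
    rw [← mul_pow]
    have hL0 : 0 ≤ L := by
      by_contra! hneg
      have := (abs_nonneg _).trans (hL x y)
      nlinarith
    exact pow_le_pow_left₀ (abs_nonneg _)
      ((hL x y).trans (mul_le_mul_of_nonneg_left hj' hL0)) 2

/-- Bounded Lipschitz functions have finite energy. -/
theorem energy_lt_top_of_lipschitz [IsFiniteMeasure μ] [OpensMeasurableSpace X] (hδ : 0 < δ)
    (h : IsAhlforsRegular δ μ) {f : X → ℝ} {L : ℝ} (hf : ∀ x y, |f x - f y| ≤ 1)
    (hL : ∀ x y, |f x - f y| ≤ L * dist x y) : energy δ μ f < ∞ := by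
  rcases eq_or_ne (Metric.ediam (Set.univ : Set X)) 0 with h0 | h0
  · rw [Metric.ediam_eq_zero_iff] at h0
    have : ∀ x y, f x - f y = 0 := fun x y => by
      rw [h0 (Set.mem_univ x) (Set.mem_univ y), sub_self]
    simp [energy, this]
  obtain ⟨C, hC, hball⟩ := h.exists_measure_closedBall_le hδ h0
  -- At scale `j` the ball volume cancels the kernel up to the factor `2 ^ δ`; the remaining
  -- `4^(-j)` comes from the squared Lipschitz bound.
  have hsum : Summable fun j : ℕ => L ^ 2 * 2 ^ δ * C * (1 / 4 : ℝ) ^ j :=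
    (summable_geometric_of_lt_one (by norm_num) (by norm_num)).mul_left _
  set K : ℝ≥0∞ := μ Set.univ + ∑' j : ℕ, ENNReal.ofReal (L ^ 2 * 2 ^ δ * C * (1 / 4 : ℝ) ^ j)
    with hK
  have hKfin : K < ∞ :=
    ENNReal.add_lt_top.2 ⟨measure_lt_top _ _, hsum.tsum_ofReal_ne_top.lt_top⟩
  have hslice : ∀ x, ∫⁻ y, ENNReal.ofReal (|f x - f y| ^ 2 / dist x y ^ δ) ∂μ ≤ K := by
    intro x
    refine (lintegral_mono fun y => ofReal_density_le_tsum hδ hf hL x y).trans ?_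
    rw [lintegral_add_left measurable_const, lintegral_one, lintegral_tsum fun j =>
      (measurable_const.indicator Metric.isClosed_closedBall.measurableSet).aemeasurable]
    refine add_le_add le_rfl (ENNReal.tsum_le_tsum fun j => ?_)
    rw [lintegral_indicator_const Metric.isClosed_closedBall.measurableSet]
    refine (mul_le_mul_right (hball x _ (by positivity)) _).trans (le_of_eq ?_)
    rw [← ENNReal.ofReal_mul (by positivity)]
    congr 1
    have h1 : ((1 / 2 : ℝ) ^ j) ^ δ ≠ 0 := by positivity
    have h2 : ((1 / 2 : ℝ) ^ (j + 1)) ^ δ = ((1 / 2 : ℝ) ^ j) ^ δ * (2 ^ δ)⁻¹ := by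
      rw [pow_succ, Real.mul_rpow (by positivity) (by norm_num), one_div, Real.inv_rpow (by norm_num)]
    have h3 : ((1 / 2 : ℝ) ^ j) ^ 2 = (1 / 4) ^ j := by
      rw [← pow_mul, mul_comm, pow_mul]; norm_num
    rw [h2, h3]
    field_simp
  refine (lintegral_mono hslice).trans_lt ?_
  rw [lintegral_const]
  exact ENNReal.mul_lt_top hKfin (measure_lt_top _ _)

variable [SecondCountableTopology X] [BorelSpace X] [IsFiniteMeasure μ]

/-- The form domain is dense in `L²(X, μ)`. -/
theorem eq_zero_of_inner_embedding_eq_zero (hδ : 0 < δ) (hμ : IsAhlforsRegular δ μ)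
    {h : Lp ℝ 2 μ} (hh : ∀ g : FormDomain δ μ, inner ℝ (embedding δ μ g) h = 0) : h = 0 := by
  have hint : Integrable h μ := (Lp.memLp h).integrable one_le_two
  refine (Lp.eq_zero_iff_ae_eq_zero).2
    (ae_eq_zero_of_forall_setIntegral_isClosed_eq_zero hint fun s hs => ?_)
  have hpos : ∀ n : ℕ, (0 : ℝ) < 1 / (n + 1) := fun n => Nat.one_div_pos_of_nat
  -- Lipschitz functions with values in `[0, 1]` that converge pointwise to the indicator of the
  -- closed set `s`; they lie in the form domain.
  let φ : ℕ → X → ℝ := fun n x => thickenedIndicator (hpos n) s x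
  have hφm : ∀ n, Measurable (φ n) := fun n =>
    (NNReal.continuous_coe.comp (thickenedIndicator (hpos n) s).continuous).measurable
  have hφ0 : ∀ n x, 0 ≤ φ n x := fun n x => NNReal.coe_nonneg _
  have hφ1 : ∀ n x, φ n x ≤ 1 := fun n x =>
    NNReal.coe_le_one.2 (thickenedIndicator_le_one (hpos n) s x)
  have hφb : ∀ n x, ‖φ n x‖ ≤ 1 := fun n x => by
    rw [Real.norm_eq_abs, abs_of_nonneg (hφ0 n x)]
    exact hφ1 n x
  have hzero : ∀ n, ∫ x, φ n x * h x ∂μ = 0 := by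
    intro n
    have hmem : MemLp (φ n) 2 μ :=
      MemLp.of_bound (hφm n).aestronglyMeasurable 1 (Eventually.of_forall (hφb n))
    have hE : energy δ μ (φ n) < ∞ := by
      refine energy_lt_top_of_lipschitz hδ hμ
        (L := ((1 / ((n : ℝ) + 1)).toNNReal⁻¹ : NNReal)) (fun x y => ?_) (fun x y => ?_)
      · exact abs_sub_le_of_nonneg_of_le (hφ0 n x) (hφ1 n x) (hφ0 n y) (hφ1 n y)
      · exact (lipschitzWith_thickenedIndicator (hpos n) s).dist_le_mul x y
    have hdom : hmem.toLp (φ n) ∈ formDomain δ μ := by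
      change energy δ μ _ < ∞
      rwa [energy_congr hmem.coeFn_toLp]
    have := hh ⟨hmem.toLp (φ n), hdom⟩
    change inner ℝ (hmem.toLp (φ n)) h = 0 at this
    rw [L2.inner_def] at this
    rw [← this]
    refine integral_congr_ae ?_
    filter_upwards [hmem.coeFn_toLp] with x hx
    simp [hx, mul_comm]
  have hlim : Tendsto (fun n => ∫ x, φ n x * h x ∂μ) atTop
      (nhds (∫ x, s.indicator (fun x => h x) x ∂μ)) := by
    refine tendsto_integral_of_dominated_convergence (fun x => ‖h x‖)
      (fun n => ((hφm n).aestronglyMeasurable.mul hint.aestronglyMeasurable)) hint.norm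
      (fun n => Eventually.of_forall fun x => ?_) (Eventually.of_forall fun x => ?_)
    · rw [norm_mul]
      exact mul_le_of_le_one_left (norm_nonneg _) (hφb n x)
    · have h1 := tendsto_pi_nhds.1 (thickenedIndicator_tendsto_indicator_closure hpos
        tendsto_one_div_add_atTop_nhds_zero_nat s) x
      rw [hs.closure_eq] at h1
      have h2 := ((NNReal.continuous_coe.tendsto _).comp h1).mul_const (h x)
      have h3 : ((s.indicator (fun _ => (1 : NNReal)) x : NNReal) : ℝ) * h x =
          s.indicator (fun x => h x) x := by
        by_cases hx : x ∈ s <;> simp [hx]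
      rwa [h3] at h2
  simp only [hzero] at hlim
  rw [← integral_indicator hs.measurableSet]
  exact (tendsto_nhds_unique hlim tendsto_const_nhds)

end Density

/-! ### The Laplacian through its resolvent `R = J J*`. -/

section Laplacian

variable {X : Type*} [MetricSpace X] [SecondCountableTopology X] [MeasurableSpace X] [BorelSpace X]
  {δ : ℝ} {μ : Measure X} [IsFiniteMeasure μ]

/-- As `J` is injective, `J J* h = 0` gives `J* h = 0`, so `h` is orthogonal to the dense form
domain. -/
theorem formResolvent_injective (hδ : 0 < δ) (hμ : IsAhlforsRegular δ μ) :
    Function.Injective (formResolvent δ μ) := by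
  refine (injective_iff_map_eq_zero _).2 fun h hh => ?_
  refine eq_zero_of_inner_embedding_eq_zero hδ hμ fun g => ?_
  have h1 : ContinuousLinearMap.adjoint (embedding δ μ) h = 0 :=
    embeddingₗ_injective (by rw [map_zero]; exact hh)
  rw [← ContinuousLinearMap.adjoint_inner_right, h1, inner_zero_right]

theorem formResolvent_isSymmetric :
    (formResolvent δ μ : Lp ℝ 2 μ →ₗ[ℝ] Lp ℝ 2 μ).IsSymmetric := by
  intro x y
  simp [formResolvent, ← ContinuousLinearMap.adjoint_inner_left]

/-- This turns every question about the unbounded operator into one about `R`. Injectivity is needed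
for `LinearPMap.inverse` to have the swapped graph. -/
theorem mem_graph_laplacian_iff (hR : Function.Injective (formResolvent δ μ)) {u v : Lp ℝ 2 μ} :
    (u, v) ∈ (laplacian δ μ).graph ↔ formResolvent δ μ (u + v) = u := by
  have hker : LinearMap.ker
      ((formResolvent δ μ : Lp ℝ 2 μ →ₗ[ℝ] Lp ℝ 2 μ).toPMap ⊤).toFun = ⊥ := by
    refine LinearMap.ker_eq_bot'.2 fun x hx => Subtype.ext ?_
    exact hR (by rw [ZeroMemClass.coe_zero, map_zero]; exact hx)
  set T := ((formResolvent δ μ : Lp ℝ 2 μ →ₗ[ℝ] Lp ℝ 2 μ).toPMap ⊤).inverse with hT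
  have hinv : ∀ a b : Lp ℝ 2 μ, (a, b) ∈ T.graph ↔ formResolvent δ μ b = a := by
    intro a b
    rw [hT, LinearPMap.inverse_graph hker]
    constructor
    · rintro ⟨⟨p, q⟩, hpq, hab⟩
      obtain ⟨z, hz1, hz2⟩ := (LinearPMap.mem_graph_iff _).1 hpq
      simp only [LinearEquiv.coe_coe, LinearEquiv.prodComm_apply, Prod.swap_prod_mk,
        Prod.mk.injEq] at hab
      rw [← hab.1, ← hab.2]
      dsimp only at hz1 hz2
      rw [← hz1, ← hz2]
      rfl
    · intro h
      exact ⟨(b, a), (LinearPMap.mem_graph_iff _).2 ⟨⟨b, trivial⟩, rfl, h⟩, rfl⟩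
  have hL : ∀ y : T.domain, laplacian δ μ y = -(y : Lp ℝ 2 μ) + T y := fun y => rfl
  constructor
  · intro h
    obtain ⟨y, hy1, hy2⟩ := (LinearPMap.mem_graph_iff _).1 h
    dsimp only at hy1 hy2
    have hy : u + v = T y := by rw [← hy2, ← hy1, hL y, add_neg_cancel_left]
    rw [← hinv, hy, ← hy1]
    exact T.mem_graph y
  · intro h
    obtain ⟨y, hy1, hy2⟩ := (LinearPMap.mem_graph_iff _).1 ((hinv _ _).2 h)
    dsimp only at hy1 hy2
    refine (LinearPMap.mem_graph_iff _).2 ⟨y, hy1, ?_⟩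
    dsimp only
    rw [hL y, hy1, hy2, neg_add_cancel_left]

theorem mem_eigenspace_laplacian_iff (hR : Function.Injective (formResolvent δ μ)) {t : ℝ}
    {u : Lp ℝ 2 μ} :
    u ∈ eigenspace (laplacian δ μ) t ↔ (1 + t) • formResolvent δ μ u = u := by
  change (u, t • u) ∈ (laplacian δ μ).graph ↔ _
  rw [mem_graph_laplacian_iff hR, map_add, map_smul, add_smul, one_smul]

theorem isOneAddInverse_formResolvent (hR : Function.Injective (formResolvent δ μ)) :
    IsOneAddInverse (laplacian δ μ) (formResolvent δ μ) := by
  refine ⟨fun u => (mem_graph_laplacian_iff hR).1 ((laplacian δ μ).mem_graph u), fun f => ?_⟩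
  have h : (formResolvent δ μ f, f - formResolvent δ μ f) ∈ (laplacian δ μ).graph := by
    rw [mem_graph_laplacian_iff hR, add_sub_cancel]
  obtain ⟨u, hu1, hu2⟩ := (LinearPMap.mem_graph_iff _).1 h
  dsimp only at hu1 hu2
  exact ⟨u, by rw [hu1, hu2, add_sub_cancel]⟩

/-- The nonzero eigenvectors of `Δ` have nonnegative eigenvalues. -/
theorem nonneg_of_mem_eigenspace_laplacian (hR : Function.Injective (formResolvent δ μ)) {t : ℝ}
    {u : Lp ℝ 2 μ} (hu : u ∈ eigenspace (laplacian δ μ) t) (hu0 : u ≠ 0) : 0 ≤ t := by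
  rw [mem_eigenspace_laplacian_iff hR] at hu
  set v := ContinuousLinearMap.adjoint (embedding δ μ) u with hv
  have h1 : (1 + t) • embedding δ μ v = u := hu
  have hv0 : 0 < ‖v‖ := by
    refine norm_pos_iff.2 fun h0 => hu0 ?_
    rw [← h1, h0, map_zero, smul_zero]
  -- Since `v = J* u` and `u = (1 + t) J v`, pairing gives `‖v‖² = ⟪u, J v⟫`; as `J` is a
  -- contraction, `1 + t ≥ 1`.
  have h2 : ‖v‖ ^ 2 = (1 + t) * ‖embedding δ μ v‖ ^ 2 := by
    rw [← real_inner_self_eq_norm_sq, ← real_inner_self_eq_norm_sq, ← real_inner_smul_left, h1]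
    exact ContinuousLinearMap.adjoint_inner_left _ _ _
  have h3 : ‖embedding δ μ v‖ ≤ ‖v‖ := norm_embeddingₗ_le v
  have h4 : ‖embedding δ μ v‖ ^ 2 ≤ ‖v‖ ^ 2 := pow_le_pow_left₀ (norm_nonneg _) h3 2
  by_contra! ht
  have h5 : 0 < ‖v‖ ^ 2 := by positivity
  have h6 : 0 < ‖embedding δ μ v‖ ^ 2 := by
    refine (sq_nonneg _).lt_of_ne fun h0 => ?_
    rw [← h0, mul_zero] at h2
    exact h5.ne' h2
  nlinarith

/-- If the resolvent is compact, then the eigenvectors of `Δ` span a dense subspace. -/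
theorem topologicalClosure_iSup_eigenspace_laplacian
    (hR : Function.Injective (formResolvent δ μ)) (hc : IsCompactOperator (formResolvent δ μ)) :
    (⨆ t : ℝ, eigenspace (laplacian δ μ) t).topologicalClosure = ⊤ := by
  have h := ContinuousLinearMap.orthogonalComplement_iSup_eigenspaces_eq_bot hc
    formResolvent_isSymmetric
  rw [Submodule.topologicalClosure_eq_top_iff, eq_bot_iff, ← h]
  refine Submodule.orthogonal_le (iSup_le fun r u hu => ?_)
  have hu' : formResolvent δ μ u = r • u := Module.End.mem_eigenspace_iff.1 hu
  rcases eq_or_ne r 0 with rfl | hr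
  · rw [zero_smul, ← map_zero (formResolvent δ μ)] at hu'
    rw [hR hu']
    exact zero_mem _
  -- The solution `t` of `r = (1 + t)⁻¹`; the eigenvalue `r = 0` was excluded by injectivity.
  · refine Submodule.mem_iSup_of_mem (r⁻¹ - 1) ((mem_eigenspace_laplacian_iff hR).2 ?_)
    rw [hu', smul_smul, add_sub_cancel, inv_mul_cancel₀ hr, one_smul]

/-- A lower bound for the norms in the form domain of `n` functions that are orthonormal in
`L²(X, μ)` is one for the `n`-th eigenvalue of `1 + Δ`. -/
theorem le_eigenvalue_laplacian (hR : Function.Injective (formResolvent δ μ)) {a : ℝ} {n : ℕ}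
    (hn : 0 < n)
    (hJ : ∀ (Λ : ℝ) (g : Fin n → FormDomain δ μ), Orthonormal ℝ (fun i => embedding δ μ (g i)) →
      (∀ i, ‖g i‖ ^ 2 ≤ Λ) → a ≤ Λ) :
    ((a - 1 : ℝ) : EReal) ≤ eigenvalue (laplacian δ μ) n := by
  refine le_sInf ?_
  rintro _ ⟨t, ht, rfl⟩
  have ht' : (n : Cardinal) ≤
    Module.rank ℝ ↥(⨆ r ∈ Set.Iic t, eigenspace (laplacian δ μ) r) := ht
  -- A positive dimension yields a nonzero eigenvector, hence `t ≥ 0` and `1 + t > 0`. For `n = 0`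
  -- the eigenvalue would be `⊥`.
  have hne : ∃ r ∈ Set.Iic t, ∃ u ∈ eigenspace (laplacian δ μ) r, u ≠ 0 := by
    by_contra! hcon
    have : (⨆ r ∈ Set.Iic t, eigenspace (laplacian δ μ) r) = ⊥ :=
      eq_bot_iff.2 (iSup₂_le fun r hr u hu => hcon r hr u hu)
    rw [this, rank_bot] at ht'
    exact hn.ne' (by simpa using ht')
  obtain ⟨r, hr, u, hu, hu0⟩ := hne
  have ht0 : 0 ≤ t := (nonneg_of_mem_eigenspace_laplacian hR hu hu0).trans hr
  have hs : 0 < (1 + t)⁻¹ := by positivity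
  have := le_inv_of_le_rank_iSup_eigenspace (embedding δ μ) hJ hs
    (rank_le_of_le_map_iSup_eigenspace (embedding δ μ) ?_ ht')
  · rw [inv_inv] at this
    exact EReal.coe_le_coe_iff.2 (by linarith)
  refine iSup₂_le fun r hr u hu => ?_
  rcases eq_or_ne u 0 with rfl | hu0
  · exact zero_mem _
  have hr0 := nonneg_of_mem_eigenspace_laplacian hR hu hu0
  have hr1 : 0 < 1 + r := by linarith
  have hmem : (1 + r)⁻¹ ∈ Set.Ici (1 + t)⁻¹ := by
    rw [Set.mem_Iic] at hr
    exact inv_anti₀ hr1 (by linarith)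
  refine Submodule.map_mono (le_iSup₂_of_le (1 + r)⁻¹ hmem le_rfl)
    (mem_map_eigenspace_adjoint_comp_self (embedding δ μ) (inv_ne_zero hr1.ne') ?_)
  rw [mem_eigenspace_laplacian_iff hR] at hu
  rw [eq_inv_smul_iff₀ hr1.ne']
  exact hu

end Laplacian

end LogLaplacian

/-! ### The conclusions, from the counting bound. -/

theorem theorem3p5 {X : Type*} [MetricSpace X] [LocallyCompactSpace X]
    [SecondCountableTopology X] [MeasurableSpace X] [BorelSpace X]
    (μ : Measure X) [IsFiniteMeasure μ] (δ : ℝ) (hδ : 0 < δ)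
    (hμ : LogLaplacian.IsAhlforsRegular δ μ) :
    -- `(1 + Δ)⁻¹` exists as a bounded operator and lies in the logarithmic integral ideal
    (∃ S : Lp ℝ 2 μ →L[ℝ] Lp ℝ 2 μ,
      LogLaplacian.IsOneAddInverse (LogLaplacian.laplacian δ μ) S ∧
        S ∈ LogLaplacian.Li (Lp ℝ 2 μ)) ∧
    -- the eigenvectors of `Δ` span a dense subspace
    (⨆ t : ℝ, LogLaplacian.eigenspace (LogLaplacian.laplacian δ μ) t).topologicalClosure = ⊤ ∧
    -- the eigenvalues of `Δ` grow at least logarithmically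
    (∃ c : ℝ, 0 < c ∧ ∀ᶠ n : ℕ in atTop,
      ((c * Real.log n : ℝ) : EReal) ≤
        LogLaplacian.eigenvalue (LogLaplacian.laplacian δ μ) n) ∧
    -- the embedding of the form domain is compact, with singular values `O((log n)^(-1/2))`
    IsCompactOperator (LogLaplacian.embedding δ μ) ∧
    (fun n : ℕ => LogLaplacian.singularValue (LogLaplacian.embedding δ μ) n) =O[atTop]
      fun n : ℕ => (Real.log n) ^ (-(1 / 2) : ℝ) := by
  obtain ⟨c, hc, hgrow⟩ := hμ.exists_mul_log_le hδ
  have hR := LogLaplacian.formResolvent_injective hδ hμ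
  have hlog : Tendsto (fun n : ℕ => Real.log n) atTop atTop :=
    Real.tendsto_log_atTop.comp tendsto_natCast_atTop_atTop
  have hcomp : IsCompactOperator (LogLaplacian.embedding δ μ) := by
    refine LogLaplacian.isCompactOperator_of_orthonormal_bound _ fun Λ => ?_
    -- Any large `n` with `c log n > Λ` is an excluded family size.
    obtain ⟨n, hn, hn'⟩ :=
      (hgrow.and ((hlog.const_mul_atTop hc).eventually_gt_atTop Λ)).exists
    exact ⟨n, fun g hg hgΛ => hn'.not_ge (hn Λ g hg hgΛ)⟩
  have hcompR : IsCompactOperator (LogLaplacian.formResolvent δ μ) :=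
    hcomp.comp_clm (ContinuousLinearMap.adjoint (LogLaplacian.embedding δ μ))
  refine ⟨⟨LogLaplacian.formResolvent δ μ, LogLaplacian.isOneAddInverse_formResolvent hR, hcompR,
    ?_⟩, LogLaplacian.topologicalClosure_iSup_eigenspace_laplacian hR hcompR,
    ⟨c / 2, by positivity, ?_⟩, hcomp, ?_⟩
  · refine IsBigO.of_bound c⁻¹ ?_
    filter_upwards [hgrow, hlog.eventually_gt_atTop 0] with n hn hn0
    rw [Real.norm_of_nonneg (LogLaplacian.singularValue_nonneg _ _),
      Real.norm_of_nonneg (by positivity), ← mul_inv]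
    exact LogLaplacian.singularValue_comp_adjoint_le_inv _ (by positivity) hn
  -- The bound is `c log n - 1`, the shift coming from `1 + Δ`; half of `c log n` absorbs it.
  · filter_upwards [hgrow, (hlog.const_mul_atTop (half_pos hc)).eventually_ge_atTop 1,
      eventually_gt_atTop 0] with n hn hn1 hn0
    refine le_trans (EReal.coe_le_coe_iff.2 ?_) (LogLaplacian.le_eigenvalue_laplacian hR hn0 hn)
    linarith
  · refine IsBigO.of_bound (c ^ (-(1 / 2) : ℝ)) ?_
    filter_upwards [hgrow, hlog.eventually_gt_atTop 0] with n hn hn0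
    rw [Real.norm_of_nonneg (LogLaplacian.singularValue_nonneg _ _),
      Real.norm_of_nonneg (by positivity), ← Real.mul_rpow hc.le hn0.le]
    exact LogLaplacian.singularValue_sq_le_inv _ (by positivity) hn
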